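/- **Model.** An agent has a normal prior with mean $\omega_0\in\mathbb R$ and variance $\sigma_0^2>0$ and density $\mu_0$ on the state $\omega\in\mathbb R$. Given $\omega$, a signal $s$ has density $f(s|\omega)=h f_H(s|\omega)+(1-h)f_L(s|\omega)$, where $h\in[0,1]$ and $f_q(\cdot|\omega)$ is the normal density with mean $\omega$ and variance $\sigma_q^2>0$, $q\in\{H,L\}$. The agent chooses a radius $r\in[0,\infty]$ and observes a signal with density $$T_rf(s|\omega)=\frac{f(s|\omega)}{\int_{\omega_0-r}^{\omega_0+r}f(t|\omega)\,dt}\ \text{ for } |s-\omega_0|<r,\qquad T_rf(s|\omega)=0\ \text{ otherwise}$$ ($T_\infty f=f$; for $r=0$ the signal is $\omega_0$ and nothing is learned). After the signal $s$ she takes the action equal to the posterior expected state, $$a^\star(s,r)=\frac{\int\omega\,T_rf(s|\omega)\mu_0(\omega)\,d\omega}{\int T_rf(s|\omega)\mu_0(\omega)\,d\omega}\quad(r>0),\qquad a^\star(s,0)=\omega_0 .$$ A radius $r^\star\in[0,\infty]$ is *optimal* if it minimizes over $r\in[0,\infty]$ the expected loss $$\int\Bigl(\int_{\omega_0-r}^{\omega_0+r}(\omega-a^\star(s,r))^2\,T_rf(s|\omega)\,ds\Bigr)\mu_0(\omega)\,d\omega$$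 (which is understood as $\int(\omega-\omega_0)^2\mu_0(\omega)\,d\omega=\sigma_0^2$ for $r=0$). **Proposition.** Fix $\omega_0$ and $\sigma_0^2>0$, and let $\sigma_H^2>0$, $\sigma_L^2>0$ and $h\in[0,1]$ vary (along a sequence, or any filter) in such a way that $\sigma_H^2$ and $\sigma_L^2$ have limits in $(0,\infty)$ (for instance, are constant), and that $|\sigma_H^2-\sigma_L^2|\to0$ or $h\to0$ or $h\to1$. Then: 1. For all parameters along the family an optimal radius $r^\star\in[0,\infty]$ exists. 2. There are $b\in\mathbb R$ and $c>0$ such that, for every choice of optimal radii $r^\star$, one has $r^\star\to\infty$ and, for every $s\in\mathbb R$, $a^\star(s,r^\star)\to b+cs$; also $a^\star(s,\infty)\to b+cs$ for every $s$. 3. Whenever there is no quality uncertainty, that is, $\sigma_H^2=\sigma_L^2$ or $h\in\{0,1\}$, the radius $r=\infty$ (no censoring) is optimal, and it is the only optimal radius. -/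

import Mathlib

open MeasureTheory ProbabilityTheory Filter Topology
open scoped NNReal ENNReal

noncomputable section

namespace EchoChamber

/-! ### The sampling model for a prior density `μ₀` and signal densities `f s ω` given the state `ω` -/

/-- The signals at distance less than `r ∈ [0, ∞]` from `ω₀`: the interval `(ω₀ - r, ω₀ + r)` for
finite `r`, and the whole real line for `r = ∞`. -/
def signalRange (ω₀ : ℝ) (r : ℝ≥0∞) : Set ℝ :=
  {s | ENNReal.ofReal |s - ω₀| < r}

open Classical in
/-- The truncated signal density `T_r f (s | ω)`: for each state `ω`, the density `f (· | ω)`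
restricted to the signal range and divided by the probability
`F (ω₀ + r | ω) - F (ω₀ - r | ω) = ∫ t in (ω₀ - r, ω₀ + r), f (t | ω)` of that range. For `r = ∞`
the signal is not truncated. -/
def truncDensity (ω₀ : ℝ) (r : ℝ≥0∞) (f : ℝ → ℝ → ℝ) (s ω : ℝ) : ℝ :=
  if r = ⊤ then f s ω
  else if s ∈ signalRange ω₀ r then f s ω / ∫ t in signalRange ω₀ r, f t ω
  else 0

/-- The posterior density `μ₁ (ω | s, r)` of the state. For `r = 0` the signal is `ω₀` whatever the
state, so that nothing is learned and the posterior is the prior. -/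
def posteriorDensity (ω₀ : ℝ) (μ₀ : ℝ → ℝ) (f : ℝ → ℝ → ℝ) (r : ℝ≥0∞) (s ω : ℝ) : ℝ :=
  if r = 0 then μ₀ ω
  else truncDensity ω₀ r f s ω * μ₀ ω / ∫ ω', truncDensity ω₀ r f s ω' * μ₀ ω'

/-- The action `a⋆ (s, r)` taken after the signal `s`: the posterior expectation of the state. -/
def action (ω₀ : ℝ) (μ₀ : ℝ → ℝ) (f : ℝ → ℝ → ℝ) (s : ℝ) (r : ℝ≥0∞) : ℝ :=
  ∫ ω, ω * posteriorDensity ω₀ μ₀ f r s ω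

/-- The expected loss (minus the expected utility) of the radius `r`,
`∫ (∫ (ω - a⋆ (s, r))² T_r f (s | ω) ds) μ₀ (ω) dω`, as an element of `[0, ∞]`. For `r = 0` the
signal is the constant `ω₀`, with no density, and the inner integral is the value at `s = ω₀`. -/
def expectedLoss (ω₀ : ℝ) (μ₀ : ℝ → ℝ) (f : ℝ → ℝ → ℝ) (r : ℝ≥0∞) : ℝ≥0∞ :=
  if r = 0 then
    ∫⁻ ω, ENNReal.ofReal ((ω - action ω₀ μ₀ f ω₀ 0) ^ 2) * ENNReal.ofReal (μ₀ ω)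
  else
    ∫⁻ ω, (∫⁻ s in signalRange ω₀ r,
      ENNReal.ofReal ((ω - action ω₀ μ₀ f s r) ^ 2 * truncDensity ω₀ r f s ω))
        * ENNReal.ofReal (μ₀ ω)

/-! ### Normal prior and normal signals -/

/-- Parameters of the model: prior mean, prior variance, variances of the high-type and of the
low-type signals, and the share of high-type sources. -/
structure NormalParams where
  ω₀ : ℝ
  v₀ : ℝ≥0
  vH : ℝ≥0
  vL : ℝ≥0
  h : ℝ

namespace NormalParams

/-- The prior density: normal with mean `ω₀` and variance `v₀`. -/
def prior (P : NormalParams) (ω : ℝ) : ℝ := gaussianPDFReal P.ω₀ P.v₀ ω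

/-- The density of a signal `s` given the state `ω`: a mixture of two normal densities with mean
`ω`. -/
def signal (P : NormalParams) (s ω : ℝ) : ℝ :=
  P.h * gaussianPDFReal ω P.vH s + (1 - P.h) * gaussianPDFReal ω P.vL s

/-- The optimal action `a⋆ (s, r)`. -/
def optAction (P : NormalParams) (s : ℝ) (r : ℝ≥0∞) : ℝ :=
  action P.ω₀ P.prior P.signal s r

/-- The radius `r ∈ [0, ∞]` minimizes the expected loss among all radii in `[0, ∞]`. -/
def IsOptimalRadius (P : NormalParams) (r : ℝ≥0∞) : Prop :=
  ∀ r' : ℝ≥0∞,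
    expectedLoss P.ω₀ P.prior P.signal r ≤ expectedLoss P.ω₀ P.prior P.signal r'

end NormalParams

end EchoChamber

end

noncomputable section

namespace EchoChamber

/-! ### Signal ranges -/

/-! Suppose first that the signal is a single normal law of variance `v`. Without censoring, the
linear rule of slope `v₀ / (v₀ + v)` has loss `v₀ v / (v₀ + v)` (`Admissible.loss_top_le`). Every
finite positive radius does strictly worse, by the Bayesian Cramér–Rao (van Trees) inequality: the
loss is at least the reciprocal of the information. The prior contributes `1 / v₀` to it, and the
signal contributes its conditional variance divided by `v ^ 2`, averaged over the state. This is
less than `1 / v`, because truncating a normal law to an interval lowers its variance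
(`truncated_gaussian_moments`, `lt_loss_of_single_quality`). Radius `0` has loss `v₀`, which is also
larger. Hence `∞` is the only optimum.

In general the loss is lower semicontinuous jointly in the variances, the share and the radius in
`[0, ∞]` (`Converges.loss_le_liminf`). At a positive limiting radius this is Fatou's lemma, the
posterior means converging by dominated convergence. At radius `0` the signal densities blow up, and
`Admissible.le_loss_ofReal` shows instead that a signal confined to a tiny interval carries almost
no information. Compactness of `[0, ∞]` then gives an optimal radius.

For the limits, pass to ultrafilters finer than the given filter: along each of them the share and
the optimal radius converge, and the limiting model has a single normal signal. If the limiting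
radius were finite, semicontinuity would keep the optimal losses above a level exceeding `v₀ v / (v₀
+ v)`, whereas the uncensored linear rule has a loss tending to that value
(`eq_top_of_tendsto_isOptimalRadius`). So the radius tends to `∞`, and the actions tend to the
conjugate posterior mean, affine in `s` with slope `v₀ / (v₀ + v)`. -/

lemma mem_signalRange {ω₀ s : ℝ} {r : ℝ≥0∞} :
    s ∈ signalRange ω₀ r ↔ ENNReal.ofReal |s - ω₀| < r := Iff.rfl

lemma measurableSet_signalRange (ω₀ : ℝ) (r : ℝ≥0∞) : MeasurableSet (signalRange ω₀ r) :=
  measurableSet_lt (by fun_prop) measurable_const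

lemma isOpen_signalRange (ω₀ : ℝ) (r : ℝ≥0∞) : IsOpen (signalRange ω₀ r) :=
  isOpen_lt (ENNReal.continuous_ofReal.comp (by fun_prop)) continuous_const

@[simp] lemma signalRange_top (ω₀ : ℝ) : signalRange ω₀ ⊤ = Set.univ := by
  ext s; simp [signalRange]

lemma signalRange_ofReal (ω₀ ρ : ℝ) :
    signalRange ω₀ (ENNReal.ofReal ρ) = Set.Ioo (ω₀ - ρ) (ω₀ + ρ) := by
  ext s
  rw [mem_signalRange, ENNReal.ofReal_lt_ofReal_iff', Set.mem_Ioo]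
  constructor
  · rintro ⟨h, -⟩
    rw [abs_lt] at h
    constructor <;> linarith [h.1, h.2]
  · rintro ⟨h1, h2⟩
    have : |s - ω₀| < ρ := by rw [abs_lt]; constructor <;> linarith
    exact ⟨this, (abs_nonneg _).trans_lt this⟩

lemma signalRange_mono (ω₀ : ℝ) {r r' : ℝ≥0∞} (h : r ≤ r') :
    signalRange ω₀ r ⊆ signalRange ω₀ r' := fun _ hs => lt_of_lt_of_le hs h

lemma volume_signalRange_pos (ω₀ : ℝ) {r : ℝ≥0∞} (hr : r ≠ 0) :
    0 < volume (signalRange ω₀ r) :=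
  (isOpen_signalRange ω₀ r).measure_pos volume
    ⟨ω₀, by rw [mem_signalRange]; simpa using pos_iff_ne_zero.2 hr⟩

/-- The signals at distance exactly `r` from `ω₀` are negligible. -/
lemma ae_ofReal_dist_ne (ω₀ : ℝ) (r : ℝ≥0∞) :
    ∀ᵐ s : ℝ, ENNReal.ofReal |s - ω₀| ≠ r := by
  -- For `r = ⊤` the set is `{ω₀}`, since `toReal` sends `⊤` to `0`; this is harmless.
  have hfin : ({ω₀ + r.toReal, ω₀ - r.toReal} : Set ℝ).Finite := by simp
  have := hfin.countable.ae_notMem (volume : Measure ℝ)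
  filter_upwards [this] with s hs heq
  apply hs
  have h1 : |s - ω₀| = r.toReal := by rw [← heq, ENNReal.toReal_ofReal (abs_nonneg _)]
  rcases abs_eq_abs.1 (h1.trans (abs_of_nonneg ENNReal.toReal_nonneg).symm) with h | h
  · left; linarith
  · right; rw [Set.mem_singleton_iff]; linarith

/-! ### Gaussian densities -/

lemma continuous_gaussianPDFReal_uncurry (v : ℝ≥0) :
    Continuous fun p : ℝ × ℝ => gaussianPDFReal p.1 v p.2 := by
  simp only [gaussianPDFReal]
  fun_prop

lemma hasDerivAt_gaussianPDFReal (m : ℝ) {v : ℝ≥0} (x : ℝ) (hv : v ≠ 0) :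
    HasDerivAt (gaussianPDFReal m v) (-(x - m) / v * gaussianPDFReal m v x) x := by
  have hv' : (v : ℝ) ≠ 0 := by exact_mod_cast hv
  have h1 : HasDerivAt (fun y => -(y - m) ^ 2 / (2 * (v : ℝ))) (-(x - m) / v) x := by
    have := (((hasDerivAt_id x).sub_const m).pow 2).neg.div_const (2 * (v : ℝ))
    refine this.congr_deriv ?_
    simp only [id]
    field_simp
    push_cast
    ring
  have h2 := h1.exp.const_mul (√(2 * Real.pi * v))⁻¹
  refine h2.congr_deriv ?_
  simp only [gaussianPDFReal]
  ring

/-- Exponential moments of a normal density. -/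
lemma integrable_exp_mul_abs_mul_gaussianPDFReal (m : ℝ) {v : ℝ≥0} (hv : v ≠ 0) (c : ℝ) :
    Integrable fun x => Real.exp (c * |x - m|) * gaussianPDFReal m v x := by
  have h1 : ∀ t : ℝ, Integrable (fun x => Real.exp (t * (x - m))) (gaussianReal m v) := by
    intro t
    have := (integrable_exp_mul_gaussianReal (μ := m) (v := v) t).mul_const (Real.exp (-(t * m)))
    refine this.congr (Eventually.of_forall fun x => ?_)
    simp only
    rw [← Real.exp_add]; ring_nf
  have h2 : Integrable (fun x => Real.exp (c * |x - m|)) (gaussianReal m v) :=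
    integrable_exp_mul_abs (h1 c) (h1 (-c))
  rw [gaussianReal_of_var_ne_zero _ hv, integrable_withDensity_iff_integrable_smul'
    (measurable_gaussianPDF m v) (ae_of_all _ fun _ => gaussianPDF_lt_top)] at h2
  refine h2.congr (Eventually.of_forall fun x => ?_)
  simp only [toReal_gaussianPDF, smul_eq_mul]
  ring

lemma integral_mul_gaussianPDFReal (m : ℝ) {v : ℝ≥0} (hv : v ≠ 0) :
    ∫ x, x * gaussianPDFReal m v x = m := by
  have := integral_id_gaussianReal (μ := m) (v := v)
  rw [integral_gaussianReal_eq_integral_smul hv] at this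
  simpa [mul_comm] using this

lemma integral_sub_sq_mul_gaussianPDFReal (m : ℝ) {v : ℝ≥0} (hv : v ≠ 0) :
    ∫ x, (x - m) ^ 2 * gaussianPDFReal m v x = v := by
  have := variance_fun_id_gaussianReal (μ := m) (v := v)
  rw [variance_eq_integral (by fun_prop), integral_id_gaussianReal,
    integral_gaussianReal_eq_integral_smul hv] at this
  simpa [mul_comm] using this

/-- Two values of a normal density at distance at most `ρ` from `c` are comparable. -/
lemma gaussianPDFReal_le_mul_exp {c ρ ω s t u : ℝ} {v : ℝ≥0} (hu : 0 < u) (huv : u ≤ v)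
    (hs : |s - c| ≤ ρ) (ht : |t - c| ≤ ρ) :
    gaussianPDFReal ω v t ≤
      gaussianPDFReal ω v s * Real.exp (2 * ρ * (ρ + |ω - c|) / u) := by
  have hv : (0 : ℝ) < v := hu.trans_le huv
  have hρ : 0 ≤ ρ := (abs_nonneg _).trans hs
  simp only [gaussianPDFReal]
  rw [mul_assoc _ _ (Real.exp _), ← Real.exp_add]
  gcongr
  have h1 : ((s - ω) ^ 2 - (t - ω) ^ 2) ≤ (2 * ρ) * (2 * (ρ + |ω - c|)) := by
    have : (s - ω) ^ 2 - (t - ω) ^ 2 = (s - t) * (s + t - 2 * ω) := by ring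
    rw [this]
    refine (le_abs_self _).trans ?_
    rw [abs_mul]
    gcongr
    · calc |s - t| = |(s - c) - (t - c)| := by ring_nf
        _ ≤ |s - c| + |t - c| := abs_sub _ _
        _ ≤ 2 * ρ := by linarith
    · calc |s + t - 2 * ω| = |(s - c) + (t - c) - 2 * (ω - c)| := by ring_nf
        _ ≤ |(s - c) + (t - c)| + |2 * (ω - c)| := abs_sub _ _
        _ ≤ |s - c| + |t - c| + 2 * |ω - c| := by
          rw [abs_mul, abs_two]; gcongr; exact abs_add_le _ _
        _ ≤ 2 * (ρ + |ω - c|) := by linarith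
  have h2 : ((s - ω) ^ 2 - (t - ω) ^ 2) / (2 * v) ≤ 2 * ρ * (ρ + |ω - c|) / u := by
    calc ((s - ω) ^ 2 - (t - ω) ^ 2) / (2 * v)
        ≤ (2 * ρ) * (2 * (ρ + |ω - c|)) / (2 * v) := by gcongr
      _ = 2 * ρ * (ρ + |ω - c|) / v := by field_simp
      _ ≤ 2 * ρ * (ρ + |ω - c|) / u := by gcongr
  have h3 : ((s - ω) ^ 2 - (t - ω) ^ 2) / (2 * v)
      = -(t - ω) ^ 2 / (2 * v) - -(s - ω) ^ 2 / (2 * v) := by ring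
  linarith

/-! ### Admissible parameters and two-sided bounds for the truncated density -/

namespace NormalParams

/-- Positive variances, and a share of high-type sources in `[0, 1]`. -/
structure Admissible (P : NormalParams) : Prop where
  v₀_pos : 0 < P.v₀
  vH_pos : 0 < P.vH
  vL_pos : 0 < P.vL
  h_mem : P.h ∈ Set.Icc (0 : ℝ) 1

/-- The probability of the signal range of radius `r` given the state `ω`. -/
def mass (P : NormalParams) (r : ℝ≥0∞) (ω : ℝ) : ℝ := ∫ t in signalRange P.ω₀ r, P.signal t ω

/-- The truncated signal density of the model. -/
def trunc (P : NormalParams) (r : ℝ≥0∞) (s ω : ℝ) : ℝ := truncDensity P.ω₀ r P.signal s ω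

variable {P : NormalParams}

lemma continuous_signal (P : NormalParams) : Continuous fun p : ℝ × ℝ => P.signal p.1 p.2 := by
  have h1 := (continuous_gaussianPDFReal_uncurry P.vH).comp continuous_swap
  have h2 := (continuous_gaussianPDFReal_uncurry P.vL).comp continuous_swap
  exact (continuous_const.mul h1).add (continuous_const.mul h2)

lemma measurable_prior (P : NormalParams) : Measurable P.prior := measurable_gaussianPDFReal _ _

lemma Admissible.prior_pos (hP : P.Admissible) (ω : ℝ) : 0 < P.prior ω :=
  gaussianPDFReal_pos _ _ _ hP.v₀_pos.ne'

lemma Admissible.integral_prior (hP : P.Admissible) : ∫ ω, P.prior ω = 1 :=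
  integral_gaussianPDFReal_eq_one _ hP.v₀_pos.ne'

lemma Admissible.signal_pos (hP : P.Admissible) (s ω : ℝ) : 0 < P.signal s ω := by
  have h1 := gaussianPDFReal_pos ω P.vH s hP.vH_pos.ne'
  have h2 := gaussianPDFReal_pos ω P.vL s hP.vL_pos.ne'
  obtain ⟨h3, h4⟩ := hP.h_mem
  unfold signal
  rcases h3.lt_or_eq with h | h
  · have := mul_pos h h1
    have := mul_nonneg (sub_nonneg.2 h4) h2.le
    linarith
  · rw [← h]; simpa using h2

lemma integrable_signal (P : NormalParams) (ω : ℝ) : Integrable fun s => P.signal s ω :=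
  ((integrable_gaussianPDFReal ω P.vH).const_mul _).add
    ((integrable_gaussianPDFReal ω P.vL).const_mul _)

lemma Admissible.integral_signal (hP : P.Admissible) (ω : ℝ) : ∫ s, P.signal s ω = 1 := by
  unfold signal
  rw [integral_add ((integrable_gaussianPDFReal ω P.vH).const_mul _)
    ((integrable_gaussianPDFReal ω P.vL).const_mul _), integral_const_mul, integral_const_mul,
    integral_gaussianPDFReal_eq_one _ hP.vH_pos.ne',
    integral_gaussianPDFReal_eq_one _ hP.vL_pos.ne']
  ring

lemma Admissible.mass_top (hP : P.Admissible) (ω : ℝ) : P.mass ⊤ ω = 1 := by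
  simp [mass, hP.integral_signal]

lemma Admissible.mass_pos (hP : P.Admissible) {r : ℝ≥0∞} (hr : r ≠ 0) (ω : ℝ) :
    0 < P.mass r ω := by
  unfold mass
  rw [integral_pos_iff_support_of_nonneg (fun s => (hP.signal_pos s ω).le)
    (P.integrable_signal ω).integrableOn]
  have : Function.support (fun s => P.signal s ω) = Set.univ :=
    Set.eq_univ_of_forall fun s => (hP.signal_pos s ω).ne'
  rw [this, Measure.restrict_apply_univ]
  exact volume_signalRange_pos _ hr

lemma Admissible.mass_mono (hP : P.Admissible) {r r' : ℝ≥0∞} (h : r ≤ r') (ω : ℝ) :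
    P.mass r ω ≤ P.mass r' ω :=
  setIntegral_mono_set (P.integrable_signal ω).integrableOn
    (ae_of_all _ fun s => (hP.signal_pos s ω).le) (signalRange_mono _ h).eventuallyLE

lemma measurable_mass (P : NormalParams) (r : ℝ≥0∞) : Measurable (P.mass r) := by
  have h : StronglyMeasurable (Function.uncurry fun ω t => P.signal t ω) :=
    (P.continuous_signal.comp continuous_swap).stronglyMeasurable
  exact (h.integral_prod_right (ν := volume.restrict (signalRange P.ω₀ r))).measurable

lemma Admissible.trunc_eq (hP : P.Admissible) {r : ℝ≥0∞} {s : ℝ}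
    (hs : s ∈ signalRange P.ω₀ r) (ω : ℝ) : P.trunc r s ω = P.signal s ω / P.mass r ω := by
  unfold trunc truncDensity
  split_ifs with h
  · rw [h, hP.mass_top, div_one]
  · rfl

lemma trunc_eq_zero {r : ℝ≥0∞} {s : ℝ} (hs : s ∉ signalRange P.ω₀ r) (ω : ℝ) :
    P.trunc r s ω = 0 := by
  unfold trunc truncDensity
  rw [if_neg (by rintro rfl; simp at hs), if_neg hs]

lemma ne_zero_of_mem_signalRange {ω₀ s : ℝ} {r : ℝ≥0∞} (hs : s ∈ signalRange ω₀ r) : r ≠ 0 :=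
  (bot_le.trans_lt hs).ne'

lemma Admissible.trunc_pos (hP : P.Admissible) {r : ℝ≥0∞} {s : ℝ}
    (hs : s ∈ signalRange P.ω₀ r) (ω : ℝ) : 0 < P.trunc r s ω := by
  rw [hP.trunc_eq hs]
  exact div_pos (hP.signal_pos s ω) (hP.mass_pos (ne_zero_of_mem_signalRange hs) ω)

lemma Admissible.trunc_nonneg (hP : P.Admissible) (r : ℝ≥0∞) (s ω : ℝ) : 0 ≤ P.trunc r s ω := by
  by_cases hs : s ∈ signalRange P.ω₀ r
  · exact (hP.trunc_pos hs ω).le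
  · exact (trunc_eq_zero hs ω).ge

lemma Admissible.measurable_trunc (hP : P.Admissible) (r : ℝ≥0∞) :
    Measurable fun p : ℝ × ℝ => P.trunc r p.1 p.2 := by
  have h : (fun p : ℝ × ℝ => P.trunc r p.1 p.2) =
      (Prod.fst ⁻¹' signalRange P.ω₀ r).indicator
        fun p : ℝ × ℝ => P.signal p.1 p.2 / P.mass r p.2 := by
    ext p
    by_cases hp : p.1 ∈ signalRange P.ω₀ r
    · rw [Set.indicator_of_mem (by exact hp), hP.trunc_eq hp]
    · rw [Set.indicator_of_notMem (by exact hp), trunc_eq_zero hp]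
  rw [h]
  exact (P.continuous_signal.measurable.div ((P.measurable_mass r).comp measurable_snd)).indicator
    (measurable_fst (measurableSet_signalRange _ _))

lemma Admissible.setIntegral_trunc (hP : P.Admissible) {r : ℝ≥0∞} (hr : r ≠ 0) (ω : ℝ) :
    ∫ s in signalRange P.ω₀ r, P.trunc r s ω = 1 := by
  rw [setIntegral_congr_fun (measurableSet_signalRange _ _) fun s hs => hP.trunc_eq hs ω,
    integral_div]
  have hZ := hP.mass_pos hr ω
  exact div_self (ne_of_gt hZ)

/-- Two values of the signal density at distance at most `ρ` from `ω₀` are comparable. -/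
lemma Admissible.signal_le_mul_exp (hP : P.Admissible) {u : ℝ≥0} (hu : 0 < u) (huH : u ≤ P.vH)
    (huL : u ≤ P.vL) {ρ s t : ℝ} (hs : |s - P.ω₀| ≤ ρ) (ht : |t - P.ω₀| ≤ ρ) (ω : ℝ) :
    P.signal t ω ≤ P.signal s ω * Real.exp (2 * ρ * (ρ + |ω - P.ω₀|) / u) := by
  have hu' : (0 : ℝ) < u := hu
  have h1 := gaussianPDFReal_le_mul_exp (v := P.vH) (ω := ω) hu' (by exact_mod_cast huH) hs ht
  have h2 := gaussianPDFReal_le_mul_exp (v := P.vL) (ω := ω) hu' (by exact_mod_cast huL) hs ht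
  obtain ⟨h3, h4⟩ := hP.h_mem
  unfold signal
  rw [add_mul, mul_assoc P.h, mul_assoc (1 - P.h)]
  exact add_le_add (mul_le_mul_of_nonneg_left h1 h3)
    (mul_le_mul_of_nonneg_left h2 (sub_nonneg.2 h4))

/-- Upper bound for the truncated density, uniform in the parameters. -/
lemma Admissible.trunc_le (hP : P.Admissible) {u : ℝ≥0} (hu : 0 < u) (huH : u ≤ P.vH)
    (huL : u ≤ P.vL) {ρ s : ℝ} {r : ℝ≥0∞} (hρ : 0 < ρ) (hr : ENNReal.ofReal ρ ≤ r)
    (hs : |s - P.ω₀| ≤ ρ) (ω : ℝ) :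
    P.trunc r s ω ≤ Real.exp (2 * ρ * (ρ + |ω - P.ω₀|) / u) / (2 * ρ) := by
  by_cases hsr : s ∈ signalRange P.ω₀ r
  swap
  · rw [trunc_eq_zero hsr]; positivity
  have hρ0 : ENNReal.ofReal ρ ≠ 0 := by simpa using hρ
  set K := Real.exp (2 * ρ * (ρ + |ω - P.ω₀|) / u)
  -- Integrate over `t` in the range of radius `ρ`, of length `2 * ρ`, the comparison of the signal
  -- density at `s` with that at `t`.
  have hm : P.signal s ω * (2 * ρ) ≤ P.mass (ENNReal.ofReal ρ) ω * K := by
    have : ∫ t in signalRange P.ω₀ (ENNReal.ofReal ρ), P.signal s ω = P.signal s ω * (2 * ρ) := by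
      rw [signalRange_ofReal, setIntegral_const, Real.volume_real_Ioo_of_le (by linarith)]
      simp; ring
    rw [← this]
    unfold mass
    rw [← integral_mul_const]
    refine setIntegral_mono_on ?_ ?_ (measurableSet_signalRange _ _) fun t ht => ?_
    · rw [signalRange_ofReal]; exact integrableOn_const (by simp)
    · exact ((P.integrable_signal ω).mul_const _).integrableOn
    · refine hP.signal_le_mul_exp hu huH huL ?_ hs ω
      rw [mem_signalRange, ENNReal.ofReal_lt_ofReal_iff hρ] at ht
      exact ht.le
  have hm' := hm.trans (mul_le_mul_of_nonneg_right (hP.mass_mono hr ω) (by positivity : 0 ≤ K))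
  rw [hP.trunc_eq hsr, div_le_div_iff₀ (hP.mass_pos (ne_zero_of_mem_signalRange hsr) ω)
    (by positivity)]
  linarith

/-- Lower bound for the truncated density, uniform in the parameters. -/
lemma Admissible.le_trunc (hP : P.Admissible) {u : ℝ≥0} (hu : 0 < u) (huH : u ≤ P.vH)
    (huL : u ≤ P.vL) {ρ s : ℝ} (hρ : 0 < ρ) (hs : s ∈ signalRange P.ω₀ (ENNReal.ofReal ρ))
    (ω : ℝ) :
    Real.exp (-(2 * ρ * (ρ + |ω - P.ω₀|) / u)) / (2 * ρ) ≤ P.trunc (ENNReal.ofReal ρ) s ω := by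
  have hρ0 : ENNReal.ofReal ρ ≠ 0 := by simpa using hρ
  set K := Real.exp (2 * ρ * (ρ + |ω - P.ω₀|) / u)
  have hs' : |s - P.ω₀| ≤ ρ := by
    rw [mem_signalRange, ENNReal.ofReal_lt_ofReal_iff hρ] at hs
    exact hs.le
  have hm : P.mass (ENNReal.ofReal ρ) ω ≤ P.signal s ω * K * (2 * ρ) := by
    have : ∫ t in signalRange P.ω₀ (ENNReal.ofReal ρ), P.signal s ω * K
        = P.signal s ω * K * (2 * ρ) := by
      rw [signalRange_ofReal, setIntegral_const, Real.volume_real_Ioo_of_le (by linarith)]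
      simp; ring
    rw [← this]
    unfold mass
    refine setIntegral_mono_on (P.integrable_signal ω).integrableOn ?_
      (measurableSet_signalRange _ _) fun t ht => ?_
    · rw [signalRange_ofReal]; exact integrableOn_const (by simp)
    · refine hP.signal_le_mul_exp hu huH huL hs' ?_ ω
      rw [mem_signalRange, ENNReal.ofReal_lt_ofReal_iff hρ] at ht
      exact ht.le
  rw [hP.trunc_eq hs, Real.exp_neg, div_le_div_iff₀ (by positivity) (hP.mass_pos hρ0 ω)]
  calc K⁻¹ * P.mass (ENNReal.ofReal ρ) ω ≤ K⁻¹ * (P.signal s ω * K * (2 * ρ)) := by gcongr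
    _ = P.signal s ω * (2 * ρ) := by
      have : K ≠ 0 := (Real.exp_pos _).ne'
      field_simp

end NormalParams


/-- The mean of a finite measure with density `w` minimizes the mean squared error. -/
lemma integral_sub_sq_mul_le {w : ℝ → ℝ} (hw : ∀ x, 0 ≤ w x)
    (h0 : Integrable w) (h1 : Integrable fun x => x * w x) (h2 : Integrable fun x => x ^ 2 * w x)
    (d : ℝ) :
    ∫ x, (x - (∫ y, y * w y) / ∫ y, w y) ^ 2 * w x ≤ ∫ x, (x - d) ^ 2 * w x := by
  have key : ∀ c : ℝ, ∫ x, (x - c) ^ 2 * w x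
      = (∫ x, x ^ 2 * w x) - 2 * c * (∫ x, x * w x) + c ^ 2 * ∫ x, w x := by
    intro c
    have h3 : Integrable fun x => x ^ 2 * w x - 2 * c * (x * w x) := h2.sub (h1.const_mul _)
    rw [← integral_const_mul, ← integral_const_mul, ← integral_sub h2 (h1.const_mul _),
      ← integral_add h3 (h0.const_mul _)]
    congr 1 with x
    ring
  rw [key, key]
  rcases (integral_nonneg (μ := volume) (f := w) hw).lt_or_eq with hD | hD
  · set D := ∫ y, w y
    set N := ∫ y, y * w y
    have : 0 ≤ (d - N / D) ^ 2 * D := by positivity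
    have e : (d - N / D) ^ 2 * D = d ^ 2 * D - 2 * d * N + N ^ 2 / D := by
      field_simp
      ring
    have e2 : 2 * (N / D) * N = 2 * (N ^ 2 / D) := by ring
    have e3 : (N / D) ^ 2 * D = N ^ 2 / D := by field_simp
    rw [e2, e3]
    linarith
  -- A weight of total mass `0` vanishes almost everywhere, so both errors are `0` whatever the
  -- quotient `0 / 0` is.
  · have hw0 : w =ᵐ[volume] 0 := (integral_eq_zero_iff_of_nonneg hw h0).1 hD.symm
    have : ∫ y, y * w y = 0 := by
      rw [integral_eq_zero_of_ae]
      filter_upwards [hw0] with x hx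
      simp [hx]
    simp [← hD, this]

/-! ### Joint density, posterior mean and loss -/

namespace NormalParams

variable {P : NormalParams}

/-- Joint density of the truncated signal and the state. -/
def joint (P : NormalParams) (r : ℝ≥0∞) (s ω : ℝ) : ℝ := P.trunc r s ω * P.prior ω

lemma Admissible.joint_nonneg (hP : P.Admissible) (r : ℝ≥0∞) (s ω : ℝ) : 0 ≤ P.joint r s ω :=
  mul_nonneg (hP.trunc_nonneg r s ω) (hP.prior_pos ω).le

lemma joint_eq_zero {r : ℝ≥0∞} {s : ℝ} (hs : s ∉ signalRange P.ω₀ r) (ω : ℝ) :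
    P.joint r s ω = 0 := by
  rw [joint, trunc_eq_zero hs, zero_mul]

lemma Admissible.measurable_joint (hP : P.Admissible) (r : ℝ≥0∞) :
    Measurable fun p : ℝ × ℝ => P.joint r p.1 p.2 :=
  (hP.measurable_trunc r).mul (P.measurable_prior.comp measurable_snd)

lemma Admissible.measurable_joint_right (hP : P.Admissible) (r : ℝ≥0∞) (s : ℝ) :
    Measurable fun ω => P.joint r s ω :=
  Measurable.comp (g := fun p : ℝ × ℝ => P.joint r p.1 p.2) (f := fun ω => (s, ω))
    (hP.measurable_joint r) measurable_prodMk_left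

/-- Valid for every `s`: outside the signal range both integrals vanish and the quotient is `0 / 0 =
0`, in agreement with the definition of the posterior. -/
lemma optAction_eq {r : ℝ≥0∞} (hr : r ≠ 0) (s : ℝ) :
    P.optAction s r = (∫ ω, ω * P.joint r s ω) / ∫ ω, P.joint r s ω := by
  unfold optAction action posteriorDensity
  simp only [if_neg hr]
  rw [← integral_div]
  congr 1 with ω
  simp only [joint, trunc]
  ring

lemma Admissible.optAction_zero (hP : P.Admissible) (s : ℝ) : P.optAction s 0 = P.ω₀ := by
  unfold optAction action posteriorDensity
  simp only [if_true]
  exact integral_mul_gaussianPDFReal _ hP.v₀_pos.ne'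

lemma Admissible.measurable_optAction (hP : P.Admissible) (r : ℝ≥0∞) :
    Measurable fun s => P.optAction s r := by
  rcases eq_or_ne r 0 with rfl | hr
  · simp only [hP.optAction_zero, measurable_const]
  simp only [optAction_eq hr]
  have h1 : StronglyMeasurable (Function.uncurry fun s ω => ω * P.joint r s ω) :=
    (measurable_snd.mul (hP.measurable_joint r)).stronglyMeasurable
  have h2 : StronglyMeasurable (Function.uncurry fun s ω => P.joint r s ω) :=
    (hP.measurable_joint r).stronglyMeasurable
  exact h1.integral_prod_right.measurable.div h2.integral_prod_right.measurable

/-- Uniform bound for the joint density. -/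
lemma Admissible.joint_le (hP : P.Admissible) {u : ℝ≥0} (hu : 0 < u) (huH : u ≤ P.vH)
    (huL : u ≤ P.vL) {ρ s : ℝ} {r : ℝ≥0∞} (hρ : 0 < ρ) (hr : ENNReal.ofReal ρ ≤ r)
    (hs : |s - P.ω₀| ≤ ρ) (ω : ℝ) :
    P.joint r s ω ≤ Real.exp (2 * ρ * ρ / u) / (2 * ρ) *
      (Real.exp (2 * ρ / u * |ω - P.ω₀|) * P.prior ω) := by
  refine (mul_le_mul_of_nonneg_right (hP.trunc_le hu huH huL hρ hr hs ω)
    (hP.prior_pos ω).le).trans_eq ?_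
  rw [show 2 * ρ * (ρ + |ω - P.ω₀|) / u = 2 * ρ * ρ / u + 2 * ρ / u * |ω - P.ω₀| by ring,
    Real.exp_add]
  ring

/-- Provides the finite radius at which the bounds on the truncated density apply, also when `r =
⊤`. Strictness on the side of `r` lets the same radius serve for all nearby `r`. -/
lemma exists_radius_of_mem_signalRange {ω₀ s : ℝ} {r : ℝ≥0∞} (hs : s ∈ signalRange ω₀ r) :
    ∃ ρ : ℝ, |s - ω₀| < ρ ∧ ENNReal.ofReal ρ < r := by
  rw [mem_signalRange] at hs
  obtain ⟨x, h1, h2⟩ := exists_between hs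
  have hx : x ≠ ⊤ := h2.ne_top
  refine ⟨x.toReal, ?_, by rwa [ENNReal.ofReal_toReal hx]⟩
  rwa [← ENNReal.ofReal_lt_iff_lt_toReal (abs_nonneg _) hx]

lemma Admissible.integrable_exp_mul_prior (hP : P.Admissible) (c : ℝ) :
    Integrable fun ω => Real.exp (c * |ω - P.ω₀|) * P.prior ω :=
  integrable_exp_mul_abs_mul_gaussianPDFReal _ (ne_of_gt hP.v₀_pos) c

/-- Functions of exponential growth are integrable against the joint density. -/
lemma Admissible.integrable_mul_joint (hP : P.Admissible) {r : ℝ≥0∞} {s : ℝ}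
    (hs : s ∈ signalRange P.ω₀ r) {φ : ℝ → ℝ} (hφ : Measurable φ) {C c : ℝ}
    (hb : ∀ ω, |φ ω| ≤ C * Real.exp (c * |ω - P.ω₀|)) :
    Integrable fun ω => φ ω * P.joint r s ω := by
  obtain ⟨ρ, h1, h2⟩ := exists_radius_of_mem_signalRange hs
  have hρ : 0 < ρ := (abs_nonneg _).trans_lt h1
  have hu : 0 < min P.vH P.vL := lt_min hP.vH_pos hP.vL_pos
  set u := min P.vH P.vL
  set M := Real.exp (2 * ρ * ρ / u) / (2 * ρ)
  refine ((hP.integrable_exp_mul_prior (c + 2 * ρ / u)).const_mul (C * M)).mono'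
    (hφ.mul (hP.measurable_joint_right r s)).aestronglyMeasurable (ae_of_all _ fun ω => ?_)
  rw [Real.norm_eq_abs, abs_mul, abs_of_nonneg (hP.joint_nonneg r s ω), add_mul, Real.exp_add]
  calc |φ ω| * P.joint r s ω ≤ (C * Real.exp (c * |ω - P.ω₀|)) *
        (M * (Real.exp (2 * ρ / u * |ω - P.ω₀|) * P.prior ω)) :=
      mul_le_mul (hb ω) (hP.joint_le hu (min_le_left _ _) (min_le_right _ _) hρ h2.le h1.le ω)
        (hP.joint_nonneg _ _ _) ((abs_nonneg _).trans (hb ω))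
    _ = _ := by ring

/-- Affine functions are dominated by exponentials. -/
lemma abs_affine_le_exp (a b c x : ℝ) :
    |a * x + b| ≤ (|a| + |a * c + b|) * Real.exp (1 * |x - c|) := by
  have h : a * x + b = a * (x - c) + (a * c + b) := by ring
  have h2 := Real.add_one_le_exp |x - c|
  have h3 := abs_nonneg (x - c)
  rw [h, one_mul]
  refine (abs_add_le _ _).trans ?_
  rw [abs_mul]
  have h4 := abs_nonneg a
  have h5 := abs_nonneg (a * c + b)
  nlinarith

lemma Admissible.integrable_joint (hP : P.Admissible) {r : ℝ≥0∞} {s : ℝ}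
    (hs : s ∈ signalRange P.ω₀ r) : Integrable fun ω => P.joint r s ω := by
  simpa using hP.integrable_mul_joint hs (φ := fun _ => 1) measurable_const (C := 1) (c := 0)
    (by simp)

lemma Admissible.integrable_id_mul_joint (hP : P.Admissible) {r : ℝ≥0∞} {s : ℝ}
    (hs : s ∈ signalRange P.ω₀ r) : Integrable fun ω => ω * P.joint r s ω :=
  hP.integrable_mul_joint hs (φ := fun ω => ω) measurable_id (C := 1 + |P.ω₀|) (c := 1)
    fun ω => by simpa using abs_affine_le_exp 1 0 P.ω₀ ω

/-- Products of two affine functions are dominated by exponentials. -/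
lemma abs_affine_sq_le_exp (a b c x : ℝ) :
    |(a * x + b) ^ 2| ≤ (|a| + |a * c + b|) ^ 2 * Real.exp (2 * |x - c|) := by
  have h := abs_affine_le_exp a b c x
  rw [abs_pow]
  refine (pow_le_pow_left₀ (abs_nonneg _) h 2).trans_eq ?_
  rw [mul_pow, ← Real.exp_nat_mul]
  norm_num

lemma Admissible.integrable_sub_sq_mul_joint (hP : P.Admissible) {r : ℝ≥0∞} {s : ℝ}
    (hs : s ∈ signalRange P.ω₀ r) (d : ℝ) : Integrable fun ω => (ω - d) ^ 2 * P.joint r s ω :=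
  hP.integrable_mul_joint hs (φ := fun ω => (ω - d) ^ 2) (by fun_prop)
    (C := (1 + |P.ω₀ + -d|) ^ 2) (c := 2) fun ω => by
    simpa [sub_eq_add_neg] using abs_affine_sq_le_exp 1 (-d) P.ω₀ ω

lemma Admissible.integral_joint_pos (hP : P.Admissible) {r : ℝ≥0∞} {s : ℝ}
    (hs : s ∈ signalRange P.ω₀ r) : 0 < ∫ ω, P.joint r s ω := by
  rw [integral_pos_iff_support_of_nonneg (fun ω => hP.joint_nonneg r s ω)
    (hP.integrable_joint hs)]
  have : Function.support (fun ω => P.joint r s ω) = Set.univ :=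
    Set.eq_univ_of_forall fun ω => (mul_pos (hP.trunc_pos hs ω) (hP.prior_pos ω)).ne'
  rw [this]
  simp

/-- The expected loss of the radius `r`. -/
def loss (P : NormalParams) (r : ℝ≥0∞) : ℝ≥0∞ := expectedLoss P.ω₀ P.prior P.signal r

lemma Admissible.measurable_sub_sq_mul_joint (hP : P.Admissible) {r : ℝ≥0∞} {d : ℝ → ℝ}
    (hd : Measurable d) : Measurable fun p : ℝ × ℝ =>
      ENNReal.ofReal ((p.2 - d p.1) ^ 2 * P.joint r p.1 p.2) :=
  (((measurable_snd.sub (hd.comp measurable_fst)).pow_const 2).mul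
    (hP.measurable_joint r)).ennreal_ofReal

/-- The expected loss as an iterated integral, over the state first. -/
lemma Admissible.loss_eq (hP : P.Admissible) {r : ℝ≥0∞} (hr : r ≠ 0) :
    P.loss r = ∫⁻ s, ∫⁻ ω, ENNReal.ofReal ((ω - P.optAction s r) ^ 2 * P.joint r s ω) := by
  unfold loss expectedLoss
  rw [if_neg hr, lintegral_lintegral_swap
    (hP.measurable_sub_sq_mul_joint (hP.measurable_optAction r)).aemeasurable]
  congr 1 with ω
  have h : ∀ s, ENNReal.ofReal ((ω - P.optAction s r) ^ 2 * P.joint r s ω) =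
      (signalRange P.ω₀ r).indicator (fun s => ENNReal.ofReal
        ((ω - action P.ω₀ P.prior P.signal s r) ^ 2 * truncDensity P.ω₀ r P.signal s ω)
          * ENNReal.ofReal (P.prior ω)) s := by
    intro s
    by_cases hs : s ∈ signalRange P.ω₀ r
    · rw [Set.indicator_of_mem hs, ← ENNReal.ofReal_mul' (hP.prior_pos ω).le, mul_assoc]
      rfl
    · rw [Set.indicator_of_notMem hs, joint_eq_zero hs]; simp
  simp only [h]
  rw [lintegral_indicator (measurableSet_signalRange _ _),
    lintegral_mul_const' _ _ ENNReal.ofReal_ne_top]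

/-- No other decision rule does better than the posterior mean. -/
lemma Admissible.loss_le (hP : P.Admissible) {r : ℝ≥0∞} (hr : r ≠ 0) (d : ℝ → ℝ) :
    P.loss r ≤ ∫⁻ s, ∫⁻ ω, ENNReal.ofReal ((ω - d s) ^ 2 * P.joint r s ω) := by
  rw [hP.loss_eq hr]
  refine lintegral_mono fun s => ?_
  by_cases hs : s ∈ signalRange P.ω₀ r
  · have hn : ∀ c, 0 ≤ᵐ[volume] fun ω => (ω - c) ^ 2 * P.joint r s ω := fun c =>
      ae_of_all _ fun ω => mul_nonneg (sq_nonneg _) (hP.joint_nonneg r s ω)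
    rw [← ofReal_integral_eq_lintegral_ofReal (hP.integrable_sub_sq_mul_joint hs _) (hn _),
      ← ofReal_integral_eq_lintegral_ofReal (hP.integrable_sub_sq_mul_joint hs _) (hn _),
      optAction_eq hr]
    refine ENNReal.ofReal_le_ofReal (integral_sub_sq_mul_le (hP.joint_nonneg r s)
      (hP.integrable_joint hs) (hP.integrable_id_mul_joint hs) ?_ _)
    simpa using hP.integrable_sub_sq_mul_joint hs 0
  · simp [joint_eq_zero hs]

lemma Admissible.loss_zero_eq (hP : P.Admissible) :
    P.loss 0 = ∫⁻ ω, ENNReal.ofReal ((ω - P.ω₀) ^ 2 * P.prior ω) := by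
  unfold loss expectedLoss
  rw [if_pos rfl]
  congr 1 with ω
  rw [ENNReal.ofReal_mul (sq_nonneg _)]
  congr 4
  exact hP.optAction_zero _

lemma Admissible.integrable_sub_sq_mul_prior (hP : P.Admissible) :
    Integrable fun ω => (ω - P.ω₀) ^ 2 * P.prior ω := by
  refine ((hP.integrable_exp_mul_prior 2).const_mul 1).mono'
    (((measurable_id.sub_const _).pow_const 2).mul P.measurable_prior).aestronglyMeasurable
    (ae_of_all _ fun ω => ?_)
  rw [norm_mul, Real.norm_of_nonneg (hP.prior_pos ω).le, ← mul_assoc]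
  refine mul_le_mul_of_nonneg_right ?_ (hP.prior_pos ω).le
  simpa [sub_eq_add_neg] using abs_affine_sq_le_exp 1 (-P.ω₀) P.ω₀ ω

lemma Admissible.loss_zero (hP : P.Admissible) : P.loss 0 = P.v₀ := by
  rw [hP.loss_zero_eq, ← ofReal_integral_eq_lintegral_ofReal hP.integrable_sub_sq_mul_prior
    (ae_of_all _ fun ω => mul_nonneg (sq_nonneg _) (hP.prior_pos ω).le)]
  unfold prior
  rw [integral_sub_sq_mul_gaussianPDFReal _ hP.v₀_pos.ne']
  simp

end NormalParams


/-! ### The loss of linear decision rules -/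

lemma integrable_affine_sq_mul_gaussianPDFReal (a b m : ℝ) {v : ℝ≥0} (hv : v ≠ 0) :
    Integrable fun x => (a * x + b) ^ 2 * gaussianPDFReal m v x := by
  refine ((integrable_exp_mul_abs_mul_gaussianPDFReal m hv 2).const_mul
    ((|a| + |a * m + b|) ^ 2)).mono'
    ((by fun_prop : Measurable fun x : ℝ => (a * x + b) ^ 2).mul
      (measurable_gaussianPDFReal m v)).aestronglyMeasurable
    (ae_of_all _ fun x => ?_)
  rw [norm_mul, Real.norm_of_nonneg (gaussianPDFReal_nonneg _ _ _), ← mul_assoc]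
  exact mul_le_mul_of_nonneg_right (NormalParams.abs_affine_sq_le_exp a b m x)
    (gaussianPDFReal_nonneg _ _ _)

lemma integrable_mul_gaussianPDFReal (m : ℝ) {v : ℝ≥0} (hv : v ≠ 0) :
    Integrable fun x => x * gaussianPDFReal m v x := by
  refine ((integrable_exp_mul_abs_mul_gaussianPDFReal m hv 1).const_mul (1 + |m|)).mono'
    (measurable_id.mul (measurable_gaussianPDFReal m v)).aestronglyMeasurable
    (ae_of_all _ fun x => ?_)
  rw [norm_mul, Real.norm_of_nonneg (gaussianPDFReal_nonneg _ _ _), ← mul_assoc]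
  exact mul_le_mul_of_nonneg_right (by simpa using NormalParams.abs_affine_le_exp 1 0 m x)
    (gaussianPDFReal_nonneg _ _ _)

lemma integral_affine_sq_mul_gaussianPDFReal (a b m : ℝ) {v : ℝ≥0} (hv : v ≠ 0) :
    ∫ x, (a * x + b) ^ 2 * gaussianPDFReal m v x = (a * m + b) ^ 2 + a ^ 2 * v := by
  have h0 := integrable_gaussianPDFReal m v
  have h1 := integrable_mul_gaussianPDFReal m hv
  have h2 : Integrable fun x => (x - m) ^ 2 * gaussianPDFReal m v x := by
    simpa [sub_eq_add_neg] using integrable_affine_sq_mul_gaussianPDFReal 1 (-m) m hv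
  have e : ∀ x, (a * x + b) ^ 2 * gaussianPDFReal m v x
      = a ^ 2 * ((x - m) ^ 2 * gaussianPDFReal m v x) +
        (2 * a * (a * m + b) * (x * gaussianPDFReal m v x) +
        ((a * m + b) ^ 2 - 2 * a * (a * m + b) * m) * gaussianPDFReal m v x) := by
    intro x; ring
  have h3 : Integrable fun x => 2 * a * (a * m + b) * (x * gaussianPDFReal m v x) +
      ((a * m + b) ^ 2 - 2 * a * (a * m + b) * m) * gaussianPDFReal m v x :=
    (h1.const_mul _).add (h0.const_mul _)
  simp only [e]
  rw [integral_add (h2.const_mul _) h3,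
    integral_add (h1.const_mul _) (h0.const_mul _), integral_const_mul, integral_const_mul,
    integral_const_mul, integral_gaussianPDFReal_eq_one _ hv, integral_mul_gaussianPDFReal _ hv,
    integral_sub_sq_mul_gaussianPDFReal _ hv]
  ring

namespace NormalParams

variable {P : NormalParams}

/-- Without censoring, the loss is at most the one of the rule `s ↦ ω₀ + c (s - ω₀)`. -/
lemma Admissible.loss_top_le (hP : P.Admissible) (c : ℝ) :
    P.loss ⊤ ≤ ENNReal.ofReal
      ((1 - c) ^ 2 * P.v₀ + c ^ 2 * (P.h * P.vH + (1 - P.h) * P.vL)) := by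
  obtain ⟨hh0, hh1⟩ := hP.h_mem
  refine (hP.loss_le ENNReal.top_ne_zero fun s => c * (s - P.ω₀) + P.ω₀).trans ?_
  have hd : Measurable fun s => c * (s - P.ω₀) + P.ω₀ := by fun_prop
  have hm := (hP.measurable_sub_sq_mul_joint (r := ⊤) hd).aemeasurable (μ := volume.prod volume)
  rw [lintegral_lintegral_swap (f := fun s ω => ENNReal.ofReal
    ((ω - (c * (s - P.ω₀) + P.ω₀)) ^ 2 * P.joint ⊤ s ω)) hm]
  set q : ℝ := P.h * P.vH + (1 - P.h) * P.vL
  have inner : ∀ ω, ∫⁻ s, ENNReal.ofReal ((ω - (c * (s - P.ω₀) + P.ω₀)) ^ 2 * P.joint ⊤ s ω)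
      = ENNReal.ofReal (((1 - c) ^ 2 * (ω - P.ω₀) ^ 2 + c ^ 2 * q) * P.prior ω) := by
    intro ω
    -- For a fixed state the error is affine in `s`, so the inner integral is a second moment under
    -- each component of the mixture.
    have e : ∀ s, (ω - (c * (s - P.ω₀) + P.ω₀)) ^ 2 * P.joint ⊤ s ω =
        (P.h * ((-c * s + (ω + c * P.ω₀ - P.ω₀)) ^ 2 * gaussianPDFReal ω P.vH s) +
        (1 - P.h) * ((-c * s + (ω + c * P.ω₀ - P.ω₀)) ^ 2 * gaussianPDFReal ω P.vL s))
          * P.prior ω := by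
      intro s
      rw [joint, hP.trunc_eq (by simp), hP.mass_top, signal]
      ring
    have i1 := (integrable_affine_sq_mul_gaussianPDFReal (-c) (ω + c * P.ω₀ - P.ω₀) ω
      hP.vH_pos.ne').const_mul P.h
    have i2 := (integrable_affine_sq_mul_gaussianPDFReal (-c) (ω + c * P.ω₀ - P.ω₀) ω
      hP.vL_pos.ne').const_mul (1 - P.h)
    rw [← ofReal_integral_eq_lintegral_ofReal]
    · simp only [e]
      rw [integral_mul_const, integral_add i1 i2, integral_const_mul, integral_const_mul,
        integral_affine_sq_mul_gaussianPDFReal _ _ _ hP.vH_pos.ne',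
        integral_affine_sq_mul_gaussianPDFReal _ _ _ hP.vL_pos.ne']
      congr 2
      ring
    · simp only [e]
      exact (i1.add i2).mul_const _
    · exact ae_of_all _ fun s => mul_nonneg (sq_nonneg _) (hP.joint_nonneg _ _ _)
  simp only [inner]
  have hq : 0 ≤ q := add_nonneg (mul_nonneg hh0 P.vH.2) (mul_nonneg (sub_nonneg.2 hh1) P.vL.2)
  have j1 : Integrable P.prior := integrable_gaussianPDFReal _ _
  have j2 := hP.integrable_sub_sq_mul_prior
  have e : ∀ ω, ((1 - c) ^ 2 * (ω - P.ω₀) ^ 2 + c ^ 2 * q) * P.prior ω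
      = (1 - c) ^ 2 * ((ω - P.ω₀) ^ 2 * P.prior ω) + c ^ 2 * q * P.prior ω := by
    intro ω; ring
  rw [← ofReal_integral_eq_lintegral_ofReal]
  · simp only [e]
    rw [integral_add (j2.const_mul _) (j1.const_mul _), integral_const_mul, integral_const_mul,
      hP.integral_prior]
    unfold prior
    rw [integral_sub_sq_mul_gaussianPDFReal _ hP.v₀_pos.ne', mul_one]
  · simp only [e]
    exact (j2.const_mul _).add (j1.const_mul _)
  · exact ae_of_all _ fun ω => mul_nonneg (by positivity) (hP.prior_pos ω).le

end NormalParams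

/-! ### Small radii -/

/-- For a weight symmetric around `c`, the mean squared error is smallest at `c`. -/
lemma lintegral_sub_sq_mul_le_of_symm {w : ℝ → ℝ} (hw : Measurable w) (hw0 : ∀ x, 0 ≤ w x)
    {c : ℝ} (hsymm : ∀ x, w (2 * c - x) = w x) (a : ℝ) :
    ∫⁻ x, ENNReal.ofReal ((x - c) ^ 2 * w x) ≤ ∫⁻ x, ENNReal.ofReal ((x - a) ^ 2 * w x) := by
  have hm : ∀ b : ℝ, Measurable fun x => ENNReal.ofReal ((x - b) ^ 2 * w x) := fun b =>
    (((measurable_id.sub_const b).pow_const 2).mul hw).ennreal_ofReal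
  have e1 : ∫⁻ x, ENNReal.ofReal ((x - a) ^ 2 * w x)
      = ∫⁻ x, ENNReal.ofReal ((2 * c - x - a) ^ 2 * w x) := by
    rw [← lintegral_sub_left_eq_self (fun x => ENNReal.ofReal ((x - a) ^ 2 * w x)) (2 * c)]
    simp only [hsymm]
  -- Average the error with its reflection: `(x - a)² + (2c - x - a)² = 2(x - c)² + 2(c - a)²`.
  have h2 : 2 * ∫⁻ x, ENNReal.ofReal ((x - c) ^ 2 * w x)
      ≤ 2 * ∫⁻ x, ENNReal.ofReal ((x - a) ^ 2 * w x) := by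
    nth_rewrite 2 [two_mul]
    nth_rewrite 2 [e1]
    rw [← lintegral_add_left (hm a), ← lintegral_const_mul _ (hm c)]
    refine lintegral_mono fun x => ?_
    rw [← ENNReal.ofReal_add (mul_nonneg (sq_nonneg _) (hw0 x))
      (mul_nonneg (sq_nonneg _) (hw0 x)), ← ENNReal.ofReal_ofNat, ← ENNReal.ofReal_mul (by simp)]
    refine ENNReal.ofReal_le_ofReal ?_
    have := mul_nonneg (sq_nonneg (c - a)) (hw0 x)
    nlinarith
  exact (ENNReal.mul_le_mul_iff_right (by simp) (by simp)).1 h2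

namespace NormalParams

variable {P : NormalParams}

/-- Lower bound for the loss, effective for small radii. -/
lemma Admissible.le_loss_ofReal (hP : P.Admissible) {u : ℝ≥0} (hu : 0 < u) (huH : u ≤ P.vH)
    (huL : u ≤ P.vL) {ρ : ℝ} (hρ : 0 ≤ ρ) :
    ∫⁻ ω, ENNReal.ofReal ((ω - P.ω₀) ^ 2 *
        (Real.exp (-(2 * ρ * (ρ + |ω - P.ω₀|) / u)) * P.prior ω))
      ≤ P.loss (ENNReal.ofReal ρ) := by
  rcases hρ.eq_or_lt with rfl | hρ
  · simp [hP.loss_zero_eq]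
  have hρ0 : ENNReal.ofReal ρ ≠ 0 := by simpa using hρ
  set w : ℝ → ℝ := fun ω => Real.exp (-(2 * ρ * (ρ + |ω - P.ω₀|) / u)) * P.prior ω with hw
  have hw0 : ∀ ω, 0 ≤ w ω := fun ω => mul_nonneg (Real.exp_pos _).le (hP.prior_pos ω).le
  have hwm : Measurable w := by
    refine Measurable.mul ?_ P.measurable_prior
    fun_prop
  have hsymm : ∀ ω, w (2 * P.ω₀ - ω) = w ω := by
    intro ω
    have e1 : |2 * P.ω₀ - ω - P.ω₀| = |ω - P.ω₀| := by rw [abs_sub_comm]; ring_nf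
    have e2 : (2 * P.ω₀ - ω - P.ω₀) ^ 2 = (ω - P.ω₀) ^ 2 := by ring
    simp only [hw, prior, gaussianPDFReal, e1, e2]
  -- The lower bound for the joint density is `w / (2 * ρ)`, independent of `s` and symmetric around
  -- `ω₀`, so whatever action is taken the error is at least that of `ω₀`. The length `2 * ρ` of the
  -- signal range then cancels the factor.
  have hinner : ∀ s ∈ signalRange P.ω₀ (ENNReal.ofReal ρ),
      ENNReal.ofReal (2 * ρ)⁻¹ * ∫⁻ ω, ENNReal.ofReal ((ω - P.ω₀) ^ 2 * w ω) ≤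
      ∫⁻ ω, ENNReal.ofReal ((ω - P.optAction s (ENNReal.ofReal ρ)) ^ 2 *
        P.joint (ENNReal.ofReal ρ) s ω) := by
    intro s hs
    refine (mul_le_mul_right (lintegral_sub_sq_mul_le_of_symm hwm hw0 hsymm
      (P.optAction s (ENNReal.ofReal ρ))) _).trans ?_
    rw [← lintegral_const_mul' _ _ ENNReal.ofReal_ne_top]
    refine lintegral_mono fun ω => ?_
    rw [← ENNReal.ofReal_mul (by positivity)]
    refine ENNReal.ofReal_le_ofReal ?_
    have h1 := mul_le_mul_of_nonneg_right (hP.le_trunc hu huH huL hρ hs ω) (hP.prior_pos ω).le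
    calc (2 * ρ)⁻¹ * ((ω - P.optAction s (ENNReal.ofReal ρ)) ^ 2 * w ω)
        = (ω - P.optAction s (ENNReal.ofReal ρ)) ^ 2 *
          (Real.exp (-(2 * ρ * (ρ + |ω - P.ω₀|) / u)) / (2 * ρ) * P.prior ω) := by
          rw [hw]; ring
      _ ≤ _ := mul_le_mul_of_nonneg_left h1 (sq_nonneg _)
  rw [hP.loss_eq hρ0]
  refine le_trans ?_ (setLIntegral_le_lintegral (signalRange P.ω₀ (ENNReal.ofReal ρ)) _)
  refine le_trans ?_ (setLIntegral_mono' (measurableSet_signalRange _ _) hinner)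
  rw [setLIntegral_const, signalRange_ofReal, Real.volume_Ioo, mul_right_comm,
    ← ENNReal.ofReal_mul (by positivity)]
  have : (2 * ρ)⁻¹ * (P.ω₀ + ρ - (P.ω₀ - ρ)) = 1 := by field_simp; ring
  rw [this, ENNReal.ofReal_one, one_mul]

end NormalParams


/-! ### Continuity in the parameters and in the radius -/

lemma tendsto_gaussianPDFReal {ι : Type*} {l : Filter ι} {v : ι → ℝ≥0} {v' : ℝ≥0} (hv' : 0 < v')
    (hv : Tendsto v l (𝓝 v')) (m x : ℝ) :
    Tendsto (fun i => gaussianPDFReal m (v i) x) l (𝓝 (gaussianPDFReal m v' x)) := by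
  have hc : Tendsto (fun i => (v i : ℝ)) l (𝓝 (v' : ℝ)) := NNReal.tendsto_coe.2 hv
  have hpos : (0 : ℝ) < v' := hv'
  have h1 : (0 : ℝ) < 2 * Real.pi * v' := by positivity
  simp only [gaussianPDFReal]
  refine Tendsto.mul ?_ ?_
  · exact ((hc.const_mul _).sqrt).inv₀ (Real.sqrt_pos.2 h1).ne'
  · exact (Real.continuous_exp.tendsto _).comp
      (tendsto_const_nhds.div (hc.const_mul 2) (by positivity))

/-- Dominates all densities with variance in `[a, b]`: raising the variance to `b` increases the
exponential, and the constant makes up for the normalization. -/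
lemma gaussianPDFReal_le_of_var_mem {a v b : ℝ≥0} (ha : 0 < a) (hav : a ≤ v) (hvb : v ≤ b)
    (m x : ℝ) :
    gaussianPDFReal m v x
      ≤ (√(2 * Real.pi * a))⁻¹ * √(2 * Real.pi * b) * gaussianPDFReal m b x := by
  have ha' : (0 : ℝ) < a := ha
  have hv' : (0 : ℝ) < v := ha.trans_le hav
  have hb' : (0 : ℝ) < b := (ha.trans_le hav).trans_le hvb
  have hvb' : (v : ℝ) ≤ b := hvb
  have hav' : (a : ℝ) ≤ v := hav
  simp only [gaussianPDFReal]
  have e : (√(2 * Real.pi * a))⁻¹ * √(2 * Real.pi * b) *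
      ((√(2 * Real.pi * b))⁻¹ * Real.exp (-(x - m) ^ 2 / (2 * b)))
      = (√(2 * Real.pi * a))⁻¹ * Real.exp (-(x - m) ^ 2 / (2 * b)) := by
    have : √(2 * Real.pi * (b : ℝ)) ≠ 0 := (Real.sqrt_pos.2 (by positivity)).ne'
    field_simp
  rw [e]
  gcongr ?_ * Real.exp ?_
  · gcongr
  · rw [neg_div, neg_div, neg_le_neg_iff]
    gcongr

lemma eventually_mem_signalRange {ι : Type*} {l : Filter ι} {r : ι → ℝ≥0∞} {r' : ℝ≥0∞}
    (hr : Tendsto r l (𝓝 r')) {ω₀ s : ℝ} (hs : s ∈ signalRange ω₀ r') :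
    ∀ᶠ i in l, s ∈ signalRange ω₀ (r i) :=
  hr.eventually (lt_mem_nhds hs)

namespace NormalParams

section Limits

variable {ι : Type*} {l : Filter ι} {P : ι → NormalParams} {P' : NormalParams}
  {r : ι → ℝ≥0∞} {r' : ℝ≥0∞}

/-- Convergence of the parameters, with fixed prior. -/
structure Converges (P : ι → NormalParams) (l : Filter ι) (P' : NormalParams) : Prop where
  ω₀_eq : ∀ i, (P i).ω₀ = P'.ω₀
  v₀_eq : ∀ i, (P i).v₀ = P'.v₀
  vH : Tendsto (fun i => (P i).vH) l (𝓝 P'.vH)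
  vL : Tendsto (fun i => (P i).vL) l (𝓝 P'.vL)
  h : Tendsto (fun i => (P i).h) l (𝓝 P'.h)

lemma Converges.prior_eq (hc : Converges P l P') (i : ι) : (P i).prior = P'.prior := by
  unfold prior
  rw [hc.ω₀_eq, hc.v₀_eq]

lemma Converges.tendsto_signal (hc : Converges P l P') (hP' : P'.Admissible) (s ω : ℝ) :
    Tendsto (fun i => (P i).signal s ω) l (𝓝 (P'.signal s ω)) :=
  (hc.h.mul (tendsto_gaussianPDFReal hP'.vH_pos hc.vH ω s)).add
    ((hc.h.const_sub 1).mul (tendsto_gaussianPDFReal hP'.vL_pos hc.vL ω s))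

/-- The bounds on the truncated density depend on the variances only through a lower bound `u`; this
makes them uniform along the family. -/
lemma Converges.exists_lower (hc : Converges P l P') (hP' : P'.Admissible) :
    ∃ u : ℝ≥0, 0 < u ∧ ∀ᶠ i in l, u ≤ (P i).vH ∧ u ≤ (P i).vL := by
  obtain ⟨u, hu0, hu⟩ := exists_between (lt_min hP'.vH_pos hP'.vL_pos)
  refine ⟨u, hu0, ?_⟩
  filter_upwards [hc.vH.eventually (lt_mem_nhds (hu.trans_le (min_le_left _ _))),
    hc.vL.eventually (lt_mem_nhds (hu.trans_le (min_le_right _ _)))] with i h1 h2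
  exact ⟨h1.le, h2.le⟩

lemma Converges.exists_upper (hc : Converges P l P') :
    ∃ b : ℝ≥0, ∀ᶠ i in l, (P i).vH ≤ b ∧ (P i).vL ≤ b := by
  obtain ⟨b, hb⟩ := exists_gt (max P'.vH P'.vL)
  refine ⟨b, ?_⟩
  filter_upwards [hc.vH.eventually (gt_mem_nhds ((le_max_left _ _).trans_lt hb)),
    hc.vL.eventually (gt_mem_nhds ((le_max_right _ _).trans_lt hb))] with i h1 h2
  exact ⟨h1.le, h2.le⟩

variable [l.IsCountablyGenerated]

/-- Dominated convergence, hence the countably generated filter. The indicators of the ranges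
converge except at distance exactly `r'` from `ω₀`, which is a null set. -/
lemma Converges.tendsto_mass (hc : Converges P l P') (hP : ∀ i, (P i).Admissible)
    (hP' : P'.Admissible) (hr : Tendsto r l (𝓝 r')) (ω : ℝ) :
    Tendsto (fun i => (P i).mass (r i) ω) l (𝓝 (P'.mass r' ω)) := by
  obtain ⟨a, ha, hea⟩ := hc.exists_lower hP'
  obtain ⟨b, heb⟩ := hc.exists_upper
  have hmass : ∀ (Q : NormalParams) (R : ℝ≥0∞), Q.mass R ω
      = ∫ t, (signalRange Q.ω₀ R).indicator (fun t => Q.signal t ω) t := fun Q R => by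
    rw [integral_indicator (measurableSet_signalRange _ _)]; rfl
  simp only [hmass, hc.ω₀_eq]
  set M : ℝ := (√(2 * Real.pi * a))⁻¹ * √(2 * Real.pi * b)
  refine tendsto_integral_filter_of_dominated_convergence (fun t => M * gaussianPDFReal ω b t)
    ?_ ?_ ((integrable_gaussianPDFReal ω b).const_mul M) ?_
  · exact Eventually.of_forall fun i => ((P i).integrable_signal ω).aestronglyMeasurable.indicator
      (measurableSet_signalRange _ _)
  · filter_upwards [hea, heb] with i hai hbi
    refine ae_of_all _ fun t => ?_
    refine (norm_indicator_le_norm_self _ _).trans ?_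
    rw [Real.norm_of_nonneg ((hP i).signal_pos t ω).le]
    obtain ⟨h1, h2⟩ := (hP i).h_mem
    have b1 := mul_le_mul_of_nonneg_left
      (gaussianPDFReal_le_of_var_mem ha hai.1 hbi.1 ω t) h1
    have b2 := mul_le_mul_of_nonneg_left
      (gaussianPDFReal_le_of_var_mem ha hai.2 hbi.2 ω t) (sub_nonneg.2 h2)
    refine (add_le_add b1 b2).trans_eq ?_
    ring
  · filter_upwards [ae_ofReal_dist_ne P'.ω₀ r'] with t ht
    rcases lt_or_gt_of_ne ht with h | h
    · have e := eventually_mem_signalRange hr (ω₀ := P'.ω₀) (s := t) h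
      rw [Set.indicator_of_mem (by exact h)]
      refine (hc.tendsto_signal hP' t ω).congr' ?_
      filter_upwards [e] with i hi
      rw [Set.indicator_of_mem hi]
    · have hn : t ∉ signalRange P'.ω₀ r' := fun hm => lt_asymm h hm
      rw [Set.indicator_of_notMem hn]
      refine tendsto_const_nhds.congr' ?_
      filter_upwards [hr.eventually (gt_mem_nhds h)] with i hi
      have hn' : t ∉ signalRange P'.ω₀ (r i) := fun hm => lt_asymm hi hm
      rw [Set.indicator_of_notMem hn']

lemma Converges.tendsto_joint (hc : Converges P l P') (hP : ∀ i, (P i).Admissible)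
    (hP' : P'.Admissible) (hr : Tendsto r l (𝓝 r')) {s : ℝ} (hs : s ∈ signalRange P'.ω₀ r')
    (ω : ℝ) : Tendsto (fun i => (P i).joint (r i) s ω) l (𝓝 (P'.joint r' s ω)) := by
  unfold joint
  simp only [hc.prior_eq]
  refine Tendsto.mul_const _ ?_
  rw [hP'.trunc_eq hs]
  refine ((hc.tendsto_signal hP' s ω).div (hc.tendsto_mass hP hP' hr ω)
    (hP'.mass_pos (ne_zero_of_mem_signalRange hs) ω).ne').congr' ?_
  filter_upwards [eventually_mem_signalRange hr hs] with i hi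
  rw [Pi.div_apply, (hP i).trunc_eq (by rwa [hc.ω₀_eq])]

/-- Near the limit the joint density is at most an exponential of `|ω - ω₀|` times the prior, and a
normal prior integrates every such exponential. -/
lemma Converges.tendsto_integral_mul_joint (hc : Converges P l P')
    (hP : ∀ i, (P i).Admissible) (hP' : P'.Admissible) (hr : Tendsto r l (𝓝 r')) {s : ℝ}
    (hs : s ∈ signalRange P'.ω₀ r') {φ : ℝ → ℝ} (hφ : Measurable φ) {C c : ℝ}
    (hb : ∀ ω, |φ ω| ≤ C * Real.exp (c * |ω - P'.ω₀|)) :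
    Tendsto (fun i => ∫ ω, φ ω * (P i).joint (r i) s ω) l
      (𝓝 (∫ ω, φ ω * P'.joint r' s ω)) := by
  obtain ⟨u, hu, heu⟩ := hc.exists_lower hP'
  obtain ⟨ρ, h1, h2⟩ := exists_radius_of_mem_signalRange hs
  have hρ : 0 < ρ := (abs_nonneg _).trans_lt h1
  set M := Real.exp (2 * ρ * ρ / u) / (2 * ρ)
  refine tendsto_integral_filter_of_dominated_convergence
    (fun ω => C * M * (Real.exp ((c + 2 * ρ / u) * |ω - P'.ω₀|) * P'.prior ω)) ?_ ?_
    ((hP'.integrable_exp_mul_prior _).const_mul _) ?_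
  · exact Eventually.of_forall fun i =>
      (hφ.mul ((hP i).measurable_joint_right (r i) s)).aestronglyMeasurable
  · filter_upwards [heu, hr.eventually (lt_mem_nhds h2)] with i hi hri
    refine ae_of_all _ fun ω => ?_
    have hj := (hP i).joint_le hu hi.1 hi.2 hρ hri.le (by rw [hc.ω₀_eq]; exact h1.le) ω
    rw [hc.prior_eq, hc.ω₀_eq] at hj
    rw [Real.norm_eq_abs, abs_mul, abs_of_nonneg ((hP i).joint_nonneg _ s ω), add_mul,
      Real.exp_add]
    calc |φ ω| * (P i).joint (r i) s ω ≤ (C * Real.exp (c * |ω - P'.ω₀|)) *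
          (M * (Real.exp (2 * ρ / u * |ω - P'.ω₀|) * P'.prior ω)) :=
        mul_le_mul (hb ω) hj ((hP i).joint_nonneg _ _ _) ((abs_nonneg _).trans (hb ω))
      _ = _ := by ring
  · exact ae_of_all _ fun ω => (hc.tendsto_joint hP hP' hr hs ω).const_mul _

lemma Converges.tendsto_optAction (hc : Converges P l P')
    (hP : ∀ i, (P i).Admissible) (hP' : P'.Admissible) (hr : Tendsto r l (𝓝 r')) {s : ℝ}
    (hs : s ∈ signalRange P'.ω₀ r') :
    Tendsto (fun i => (P i).optAction s (r i)) l (𝓝 (P'.optAction s r')) := by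
  have h1 := hc.tendsto_integral_mul_joint hP hP' hr hs (φ := fun ω => ω) measurable_id
    (C := 1 + |P'.ω₀|) (c := 1) fun ω => by simpa using abs_affine_le_exp 1 0 P'.ω₀ ω
  have h2 := hc.tendsto_integral_mul_joint hP hP' hr hs (φ := fun _ => 1) measurable_const
    (C := 1) (c := 0) (by simp)
  simp only [one_mul] at h2
  rw [optAction_eq (ne_zero_of_mem_signalRange hs)]
  refine (h1.div h2 (hP'.integral_joint_pos hs).ne').congr' ?_
  filter_upwards [eventually_mem_signalRange hr hs] with i hi
  rw [Pi.div_apply, optAction_eq (ne_zero_of_mem_signalRange hi)]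

/-- Lower semicontinuity of the loss at a positive radius. -/
lemma Converges.loss_le_liminf_of_ne_zero [l.NeBot] (hc : Converges P l P')
    (hP : ∀ i, (P i).Admissible) (hP' : P'.Admissible) (hr : Tendsto r l (𝓝 r'))
    (hr' : r' ≠ 0) : P'.loss r' ≤ liminf (fun i => (P i).loss (r i)) l := by
  set F : ι → ℝ → ℝ → ℝ≥0∞ := fun i s ω => ENNReal.ofReal
    ((ω - (P i).optAction s (r i)) ^ 2 * (P i).joint (r i) s ω) with hF
  have hm : ∀ i, Measurable (Function.uncurry (F i)) := fun i =>
    (hP i).measurable_sub_sq_mul_joint (r := r i) (d := fun s => (P i).optAction s (r i))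
      ((hP i).measurable_optAction (r i))
  have hloss : ∀ᶠ i in l, (P i).loss (r i) = ∫⁻ s, ∫⁻ ω, F i s ω := by
    filter_upwards [hr.eventually (lt_mem_nhds (pos_iff_ne_zero.2 hr'))] with i hi
    exact (hP i).loss_eq hi.ne'
  rw [hP'.loss_eq hr', liminf_congr hloss]
  -- Fatou twice, in `s` and then in `ω`. For `s` outside the limiting range the left side is `0`,
  -- so convergence is needed only inside it.
  refine le_trans (lintegral_mono fun s => ?_)
    (lintegral_liminf_le fun i => (hm i).lintegral_prod_right)
  by_cases hs : s ∈ signalRange P'.ω₀ r'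
  · refine le_trans (lintegral_mono fun ω => ?_)
      (lintegral_liminf_le fun i => (hm i).of_uncurry_left)
    refine (Tendsto.liminf_eq ?_).ge
    refine ENNReal.tendsto_ofReal (Tendsto.mul ?_ (hc.tendsto_joint hP hP' hr hs ω))
    exact ((hc.tendsto_optAction hP hP' hr hs).const_sub ω).pow 2
  · simp [joint_eq_zero hs]

/-- Lower semicontinuity of the loss at the radius `0`. -/
lemma Converges.loss_zero_le_liminf [l.NeBot] (hc : Converges P l P')
    (hP : ∀ i, (P i).Admissible) (hP' : P'.Admissible) (hr : Tendsto r l (𝓝 0)) :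
    P'.loss 0 ≤ liminf (fun i => (P i).loss (r i)) l := by
  obtain ⟨u, hu, heu⟩ := hc.exists_lower hP'
  have hρ : Tendsto (fun i => (r i).toReal) l (𝓝 0) :=
    (ENNReal.tendsto_toReal ENNReal.zero_ne_top).comp hr
  set F : ι → ℝ → ℝ≥0∞ := fun i ω => ENNReal.ofReal ((ω - P'.ω₀) ^ 2 *
    (Real.exp (-(2 * (r i).toReal * ((r i).toReal + |ω - P'.ω₀|) / u)) * P'.prior ω)) with hF
  have hFm : ∀ i, Measurable (F i) := fun i => by
    refine (Measurable.mul (by fun_prop) (Measurable.mul (by fun_prop)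
      P'.measurable_prior)).ennreal_ofReal
  have h1 : P'.loss 0 ≤ liminf (fun i => ∫⁻ ω, F i ω) l := by
    rw [hP'.loss_zero_eq]
    refine le_trans (lintegral_mono fun ω => ?_) (lintegral_liminf_le hFm)
    refine (Tendsto.liminf_eq ?_).ge
    refine ENNReal.tendsto_ofReal (Tendsto.const_mul _ ?_)
    have h2 : Tendsto (fun i => -(2 * (r i).toReal * ((r i).toReal + |ω - P'.ω₀|) / u)) l
        (𝓝 (-(2 * 0 * (0 + |ω - P'.ω₀|) / u))) :=
      (((hρ.const_mul 2).mul (hρ.add_const _)).div_const _).neg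
    have h3 := ((Real.continuous_exp.tendsto _).comp h2).mul_const (P'.prior ω)
    simpa using h3
  refine h1.trans (liminf_le_liminf ?_)
  filter_upwards [heu, hr.eventually (gt_mem_nhds ENNReal.zero_lt_top)] with i hi hri
  have h2 := (hP i).le_loss_ofReal hu hi.1 hi.2 (ENNReal.toReal_nonneg (a := r i))
  rw [ENNReal.ofReal_toReal hri.ne, hc.prior_eq, hc.ω₀_eq] at h2
  exact h2

/-- Lower semicontinuity of the loss. -/
lemma Converges.loss_le_liminf [l.NeBot] (hc : Converges P l P')
    (hP : ∀ i, (P i).Admissible) (hP' : P'.Admissible) (hr : Tendsto r l (𝓝 r')) :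
    P'.loss r' ≤ liminf (fun i => (P i).loss (r i)) l := by
  rcases eq_or_ne r' 0 with rfl | hr'
  · exact hc.loss_zero_le_liminf hP hP' hr
  · exact hc.loss_le_liminf_of_ne_zero hP hP' hr hr'

end Limits

end NormalParams


/-! ### Truncated normal distributions -/

section TruncatedNormal

variable {v : ℝ≥0} {p q : ℝ}

lemma continuous_gaussianPDFReal (m : ℝ) (v : ℝ≥0) : Continuous (gaussianPDFReal m v) := by
  rw [gaussianPDFReal_def]
  fun_prop

/-- The first moment of a centred normal density over `[p, q]`. -/
lemma intervalIntegral_sub_mul_gaussianPDFReal (hv : v ≠ 0) (p q c : ℝ) :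
    ∫ x in p..q, (x - c) * gaussianPDFReal 0 v x =
      v * (gaussianPDFReal 0 v p - gaussianPDFReal 0 v q)
        - c * ∫ x in p..q, gaussianPDFReal 0 v x := by
  have hv' : (v : ℝ) ≠ 0 := by exact_mod_cast hv
  have hcont := continuous_gaussianPDFReal 0 v
  have h1 : ∫ x in p..q, x * gaussianPDFReal 0 v x
      = -(v : ℝ) * gaussianPDFReal 0 v q - -(v : ℝ) * gaussianPDFReal 0 v p := by
    refine intervalIntegral.integral_eq_sub_of_hasDerivAt
      (f := fun x => -(v : ℝ) * gaussianPDFReal 0 v x) (fun x _ => ?_)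
      ((continuous_id.mul hcont).intervalIntegrable _ _)
    refine ((hasDerivAt_gaussianPDFReal 0 x hv).const_mul (-(v : ℝ))).congr_deriv ?_
    field_simp
    ring
  simp only [sub_mul]
  rw [intervalIntegral.integral_sub (Continuous.intervalIntegrable (by fun_prop) _ _)
    (Continuous.intervalIntegrable (by fun_prop) _ _), h1,
    intervalIntegral.integral_const_mul]
  ring

/-- Truncation to an interval decreases the variance of a normal distribution. -/
lemma truncated_gaussian_moments (hv : v ≠ 0) (hpq : p < q) {c : ℝ}
    (hc : c = v * (gaussianPDFReal 0 v p - gaussianPDFReal 0 v q) /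
      ∫ x in p..q, gaussianPDFReal 0 v x) :
    ∫ x in p..q, (x - c) * gaussianPDFReal 0 v x = 0 ∧ p < c ∧ c < q ∧
      ∫ x in p..q, (x - c) ^ 2 * gaussianPDFReal 0 v x < v * ∫ x in p..q, gaussianPDFReal 0 v x := by
  have hv' : (0 : ℝ) < v := by exact_mod_cast pos_iff_ne_zero.2 hv
  have hcont := continuous_gaussianPDFReal 0 v
  have hpos : ∀ x, 0 < gaussianPDFReal 0 v x := fun x => gaussianPDFReal_pos 0 v x hv
  have hZ : 0 < ∫ x in p..q, gaussianPDFReal 0 v x :=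
    intervalIntegral.intervalIntegral_pos_of_pos_on (hcont.intervalIntegrable _ _)
      (fun x _ => hpos x) hpq
  have hmean : ∫ x in p..q, (x - c) * gaussianPDFReal 0 v x = 0 := by
    rw [intervalIntegral_sub_mul_gaussianPDFReal hv, hc, div_mul_cancel₀ _ hZ.ne', sub_self]
  have hcont1 : Continuous fun x => (x - c) * gaussianPDFReal 0 v x := by fun_prop
  have hpc : p < c := by
    -- If `c ≤ p`, the centred integrand would be positive on the whole interval and could not
    -- integrate to `0`.
    by_contra! h
    have := intervalIntegral.intervalIntegral_pos_of_pos_on (hcont1.intervalIntegrable p q)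
      (fun x hx => mul_pos (by linarith [hx.1]) (hpos x)) hpq
    exact this.ne' hmean
  have hcq : c < q := by
    by_contra! h
    have := intervalIntegral.intervalIntegral_pos_of_pos_on
      (f := fun x => -((x - c) * gaussianPDFReal 0 v x))
      (Continuous.intervalIntegrable (by fun_prop) p q)
      (fun x hx => by
        have := mul_pos (by linarith [hx.2] : 0 < c - x) (hpos x)
        linarith) hpq
    rw [intervalIntegral.integral_neg, hmean, neg_zero] at this
    exact lt_irrefl _ this
  refine ⟨hmean, hpc, hcq, ?_⟩
  -- Integration by parts in Stein's form: the integrand is the derivative of `-v (x - c)` times the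
  -- density. As `p < c < q`, both boundary terms are negative, which is where the variance is
  -- strictly lost.
  have h1 : ∫ x in p..q, (x * (x - c) * gaussianPDFReal 0 v x - v * gaussianPDFReal 0 v x)
      = -(v : ℝ) * ((q - c) * gaussianPDFReal 0 v q) -
        -(v : ℝ) * ((p - c) * gaussianPDFReal 0 v p) := by
    refine intervalIntegral.integral_eq_sub_of_hasDerivAt
      (f := fun x => -(v : ℝ) * ((x - c) * gaussianPDFReal 0 v x)) (fun x _ => ?_)
      (Continuous.intervalIntegrable (by fun_prop) _ _)
    refine ((((hasDerivAt_id x).sub_const c).mul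
      (hasDerivAt_gaussianPDFReal 0 x hv)).const_mul (-(v : ℝ))).congr_deriv ?_
    simp only [id]
    field_simp
    ring
  have h2 : ∫ x in p..q, (x - c) ^ 2 * gaussianPDFReal 0 v x =
      (∫ x in p..q, (x * (x - c) * gaussianPDFReal 0 v x - v * gaussianPDFReal 0 v x)) +
      (v * (∫ x in p..q, gaussianPDFReal 0 v x)
        - c * ∫ x in p..q, (x - c) * gaussianPDFReal 0 v x) := by
    rw [← intervalIntegral.integral_const_mul, ← intervalIntegral.integral_const_mul,
      ← intervalIntegral.integral_sub (Continuous.intervalIntegrable (by fun_prop) _ _)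
        (Continuous.intervalIntegrable (by fun_prop) _ _),
      ← intervalIntegral.integral_add (Continuous.intervalIntegrable (by fun_prop) _ _)
        (Continuous.intervalIntegrable (by fun_prop) _ _)]
    congr 1 with x
    ring
  rw [h2, h1, hmean]
  have b1 := mul_pos hv' (mul_pos (sub_pos.2 hcq) (hpos q))
  have b2 := mul_pos hv' (mul_pos (sub_pos.2 hpc) (hpos p))
  nlinarith

end TruncatedNormal

/-- Stated without a sign condition, because the Cramér–Rao lower bound at a given signal may be
negative. -/
lemma ofReal_integral_le_lintegral_ofReal {α : Type*} {m : MeasurableSpace α} {μ : Measure α}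
    {f : α → ℝ} (hf : Integrable f μ) :
    ENNReal.ofReal (∫ x, f x ∂μ) ≤ ∫⁻ x, ENNReal.ofReal (f x) ∂μ := by
  have h : ∀ x, ENNReal.ofReal (f x) = ENNReal.ofReal (max (f x) 0) := fun x => by simp
  simp only [h]
  rw [← ofReal_integral_eq_lintegral_ofReal hf.pos_part (ae_of_all _ fun x => le_max_right _ _)]
  exact ENNReal.ofReal_le_ofReal (integral_mono hf hf.pos_part fun x => le_max_left _ _)

/-! ### The Bayesian Cramér–Rao bound for a single signal quality -/

namespace NormalParams

variable {P : NormalParams} {v : ℝ≥0} {ρ : ℝ}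

/-- The mean of the error `s - ω` of a normal signal of variance `v`, conditionally on the state
`ω` and on the signal range of radius `ρ`. -/
def errMean (P : NormalParams) (v : ℝ≥0) (ρ ω : ℝ) : ℝ :=
  v * (gaussianPDFReal 0 v (P.ω₀ - ρ - ω) - gaussianPDFReal 0 v (P.ω₀ + ρ - ω)) /
    P.mass (ENNReal.ofReal ρ) ω

/-- The score of the joint density in the state. -/
def score (P : NormalParams) (v : ℝ≥0) (ρ s ω : ℝ) : ℝ :=
  -(ω - P.ω₀) / P.v₀ + (s - ω - P.errMean v ρ ω) / v

lemma gaussianPDFReal_eq_centered (ω : ℝ) (v : ℝ≥0) (s : ℝ) :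
    gaussianPDFReal ω v s = gaussianPDFReal 0 v (s - ω) := by
  simp [gaussianPDFReal]

lemma gaussianPDFReal_comm (ω : ℝ) (v : ℝ≥0) (s : ℝ) :
    gaussianPDFReal ω v s = gaussianPDFReal s v ω := by
  simp only [gaussianPDFReal]
  rw [← neg_sub s ω, neg_sq]

lemma setIntegral_signalRange_eq (hρ : 0 < ρ) (c ω : ℝ) (f : ℝ → ℝ) :
    ∫ s in signalRange c (ENNReal.ofReal ρ), f (s - ω) =
      ∫ x in (c - ρ - ω)..(c + ρ - ω), f x := by
  rw [signalRange_ofReal, ← integral_Ioc_eq_integral_Ioo,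
    ← intervalIntegral.integral_of_le (by linarith), intervalIntegral.integral_comp_sub_right]

lemma mass_eq_intervalIntegral (hρ : 0 < ρ)
    (hsig : ∀ s ω, P.signal s ω = gaussianPDFReal ω v s) (ω : ℝ) : P.mass (ENNReal.ofReal ρ) ω =
    ∫ x in (P.ω₀ - ρ - ω)..(P.ω₀ + ρ - ω), gaussianPDFReal 0 v x := by
  rw [← setIntegral_signalRange_eq hρ P.ω₀ ω]
  unfold mass
  congr 1 with s
  rw [hsig, gaussianPDFReal_eq_centered]

/-- The mean of a law on an interval lies inside that interval. -/
lemma errMean_mem (hv : v ≠ 0) (hρ : 0 < ρ)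
    (hsig : ∀ s ω, P.signal s ω = gaussianPDFReal ω v s) (ω : ℝ) :
    P.ω₀ - ρ - ω < P.errMean v ρ ω ∧ P.errMean v ρ ω < P.ω₀ + ρ - ω := by
  have h := truncated_gaussian_moments hv (by linarith : P.ω₀ - ρ - ω < P.ω₀ + ρ - ω)
    (c := P.errMean v ρ ω) (by rw [errMean, mass_eq_intervalIntegral hρ hsig])
  exact ⟨h.2.1, h.2.2.1⟩

lemma hasDerivAt_mass (hρ : 0 < ρ)
    (hsig : ∀ s ω, P.signal s ω = gaussianPDFReal ω v s) (ω : ℝ) :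
    HasDerivAt (P.mass (ENNReal.ofReal ρ))
      (gaussianPDFReal 0 v (P.ω₀ - ρ - ω) - gaussianPDFReal 0 v (P.ω₀ + ρ - ω)) ω := by
  have hcont := continuous_gaussianPDFReal 0 v
  have e : P.mass (ENNReal.ofReal ρ) = fun ω =>
      (∫ x in (0 : ℝ)..(P.ω₀ + ρ - ω), gaussianPDFReal 0 v x) -
        ∫ x in (0 : ℝ)..(P.ω₀ - ρ - ω), gaussianPDFReal 0 v x := by
    ext ω
    rw [mass_eq_intervalIntegral hρ hsig, intervalIntegral.integral_interval_sub_left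
      (hcont.intervalIntegrable _ _) (hcont.intervalIntegrable _ _)]
  have key : ∀ b : ℝ, HasDerivAt (fun ω => ∫ x in (0 : ℝ)..(b - ω), gaussianPDFReal 0 v x)
      (-gaussianPDFReal 0 v (b - ω)) ω := fun b => by
    have h1 : HasDerivAt (fun y => ∫ x in (0 : ℝ)..y, gaussianPDFReal 0 v x)
        (gaussianPDFReal 0 v (b - ω)) (b - ω) :=
      (hcont.integral_hasStrictDerivAt 0 _).hasDerivAt
    have h2 := h1.comp ω ((hasDerivAt_id ω).const_sub b)
    refine h2.congr_deriv (by simp)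
  rw [e]
  refine ((key _).sub (key _)).congr_deriv ?_
  ring

/-- The logarithmic derivative of the mass in `ω` is `errMean / v`: normalizing by the mass
recentres the error `s - ω` in the score at its conditional mean. -/
lemma hasDerivAt_joint (hP : P.Admissible) (hv : v ≠ 0) (hρ : 0 < ρ)
    (hsig : ∀ s ω, P.signal s ω = gaussianPDFReal ω v s) {s : ℝ} (hs : s ∈ signalRange P.ω₀ (ENNReal.ofReal ρ)) (ω : ℝ) :
    HasDerivAt (fun ω => P.joint (ENNReal.ofReal ρ) s ω)
      (P.score v ρ s ω * P.joint (ENNReal.ofReal ρ) s ω) ω := by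
  have hv' : (v : ℝ) ≠ 0 := by exact_mod_cast hv
  have hv₀ : (P.v₀ : ℝ) ≠ 0 := by exact_mod_cast hP.v₀_pos.ne'
  have hZ := (hP.mass_pos (ne_zero_of_mem_signalRange hs) ω).ne'
  have e : ∀ ω, P.joint (ENNReal.ofReal ρ) s ω =
      gaussianPDFReal s v ω / P.mass (ENNReal.ofReal ρ) ω * gaussianPDFReal P.ω₀ P.v₀ ω := by
    intro ω
    rw [joint, hP.trunc_eq hs, hsig, gaussianPDFReal_comm, prior]
  simp only [e]
  refine (((hasDerivAt_gaussianPDFReal s ω hv).div (hasDerivAt_mass hρ hsig ω) hZ).mul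
    (hasDerivAt_gaussianPDFReal P.ω₀ ω hP.v₀_pos.ne')).congr_deriv ?_
  rw [score, errMean]
  simp only [Pi.div_apply]
  field_simp
  ring

lemma measurable_score (P : NormalParams) (v : ℝ≥0) (ρ : ℝ) :
    Measurable fun x : ℝ × ℝ => P.score v ρ x.1 x.2 := by
  have h := continuous_gaussianPDFReal 0 v
  have h1 : Measurable (P.errMean v ρ) := by
    unfold errMean
    refine Measurable.div ?_ (P.measurable_mass _)
    exact (by fun_prop : Continuous _).measurable
  unfold score
  fun_prop

/-- Both `s - ω` and its conditional mean lie in one interval of length `2 * ρ`, so only the prior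
term of the score grows with `ω`. -/
lemma abs_score_le (hP : P.Admissible) (hv : v ≠ 0) (hρ : 0 < ρ)
    (hsig : ∀ s ω, P.signal s ω = gaussianPDFReal ω v s) {s : ℝ} (hs : s ∈ signalRange P.ω₀ (ENNReal.ofReal ρ)) (ω : ℝ) :
    |P.score v ρ s ω| ≤ (1 / P.v₀ + 2 * ρ / v) * Real.exp (1 * |ω - P.ω₀|) := by
  have hv' : (0 : ℝ) < v := by exact_mod_cast pos_iff_ne_zero.2 hv
  have hv₀ : (0 : ℝ) < P.v₀ := hP.v₀_pos
  obtain ⟨h1, h2⟩ := errMean_mem hv hρ hsig ω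
  rw [signalRange_ofReal] at hs
  have h3 : |s - ω - P.errMean v ρ ω| ≤ 2 * ρ := by
    rw [abs_le]; constructor <;> linarith [hs.1, hs.2]
  have h4 : |ω - P.ω₀| ≤ Real.exp (1 * |ω - P.ω₀|) := by
    rw [one_mul]; linarith [Real.add_one_le_exp |ω - P.ω₀|]
  have h5 : 1 ≤ Real.exp (1 * |ω - P.ω₀|) := Real.one_le_exp (by positivity)
  unfold score
  refine (abs_add_le _ _).trans ?_
  rw [abs_div, abs_div, abs_neg, abs_of_pos hv', abs_of_pos hv₀, add_mul]
  refine add_le_add ?_ ?_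
  · rw [div_mul_eq_mul_div, one_mul]
    gcongr
  · calc |s - ω - P.errMean v ρ ω| / v ≤ 2 * ρ / v := by gcongr
      _ ≤ _ := le_mul_of_one_le_right (by positivity) h5

/-- The conditional second moment of the score is smaller than without censoring. -/
lemma setIntegral_score_sq_mul_trunc_lt (hP : P.Admissible) (hv : v ≠ 0) (hρ : 0 < ρ)
    (hsig : ∀ s ω, P.signal s ω = gaussianPDFReal ω v s) (ω : ℝ) :
    ∫ s in signalRange P.ω₀ (ENNReal.ofReal ρ),
      P.score v ρ s ω ^ 2 * P.trunc (ENNReal.ofReal ρ) s ω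
      < (ω - P.ω₀) ^ 2 / P.v₀ ^ 2 + 1 / v := by
  have hv' : (0 : ℝ) < v := by exact_mod_cast pos_iff_ne_zero.2 hv
  have hρ0 : ENNReal.ofReal ρ ≠ 0 := by simpa using hρ
  have hZ := hP.mass_pos hρ0 ω
  have hmass := mass_eq_intervalIntegral hρ hsig ω
  obtain ⟨hmean, -, -, hvar⟩ :=
    truncated_gaussian_moments hv (by linarith : P.ω₀ - ρ - ω < P.ω₀ + ρ - ω)
    (c := P.errMean v ρ ω) (by rw [errMean, hmass])
  set p := P.ω₀ - ρ - ω
  set q := P.ω₀ + ρ - ω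
  set c := P.errMean v ρ ω with hc
  set Z := P.mass (ENNReal.ofReal ρ) ω
  set d := -(ω - P.ω₀) / (P.v₀ : ℝ) with hd
  have hcont := continuous_gaussianPDFReal 0 v
  have e : ∫ s in signalRange P.ω₀ (ENNReal.ofReal ρ),
      P.score v ρ s ω ^ 2 * P.trunc (ENNReal.ofReal ρ) s ω
      = ∫ x in p..q, (d + (x - c) / v) ^ 2 * (gaussianPDFReal 0 v x / Z) := by
    rw [← setIntegral_signalRange_eq hρ P.ω₀ ω
      fun x => (d + (x - c) / v) ^ 2 * (gaussianPDFReal 0 v x / Z)]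
    refine setIntegral_congr_fun (measurableSet_signalRange _ _) fun s hs => ?_
    rw [hP.trunc_eq hs, hsig, gaussianPDFReal_eq_centered, score]
  -- Expand the square; the cross term vanishes because `x - c` is centred.
  have e2 : ∫ x in p..q, (d + (x - c) / v) ^ 2 * (gaussianPDFReal 0 v x / Z)
      = (d ^ 2 * (∫ x in p..q, gaussianPDFReal 0 v x)
        + 2 * d / v * (∫ x in p..q, (x - c) * gaussianPDFReal 0 v x)
        + 1 / v ^ 2 * ∫ x in p..q, (x - c) ^ 2 * gaussianPDFReal 0 v x) / Z := by
    rw [← intervalIntegral.integral_const_mul, ← intervalIntegral.integral_const_mul,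
      ← intervalIntegral.integral_const_mul,
      ← intervalIntegral.integral_add (Continuous.intervalIntegrable (by fun_prop) _ _)
        (Continuous.intervalIntegrable (by fun_prop) _ _),
      ← intervalIntegral.integral_add (Continuous.intervalIntegrable (by fun_prop) _ _)
        (Continuous.intervalIntegrable (by fun_prop) _ _),
      ← intervalIntegral.integral_div]
    congr 1 with x
    field_simp
    ring
  rw [e, e2, hmean, ← hmass, div_lt_iff₀ hZ]
  rw [← hmass] at hvar
  have h3 : 1 / (v : ℝ) ^ 2 * ∫ x in p..q, (x - c) ^ 2 * gaussianPDFReal 0 v x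
      < 1 / (v : ℝ) ^ 2 * (v * Z) := mul_lt_mul_of_pos_left hvar (by positivity)
  have h4 : 1 / (v : ℝ) ^ 2 * (v * Z) = 1 / v * Z := by field_simp
  have h5 : d ^ 2 = (ω - P.ω₀) ^ 2 / (P.v₀ : ℝ) ^ 2 := by rw [hd, div_pow, neg_sq]
  rw [h5]
  linarith

/-- Bayesian Cramér–Rao inequality, conditionally on the signal. -/
lemma le_integral_sub_sq_mul_joint (hP : P.Admissible) (hv : v ≠ 0) (hρ : 0 < ρ)
    (hsig : ∀ s ω, P.signal s ω = gaussianPDFReal ω v s) {s : ℝ}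
    (hs : s ∈ signalRange P.ω₀ (ENNReal.ofReal ρ)) (a k : ℝ) :
    2 * k * (∫ ω, P.joint (ENNReal.ofReal ρ) s ω)
        - k ^ 2 * ∫ ω, P.score v ρ s ω ^ 2 * P.joint (ENNReal.ofReal ρ) s ω
      ≤ ∫ ω, (ω - a) ^ 2 * P.joint (ENNReal.ofReal ρ) s ω := by
  set r := ENNReal.ofReal ρ
  set B : ℝ := 1 / P.v₀ + 2 * ρ / v
  have hB : ∀ ω, |P.score v ρ s ω| ≤ B * Real.exp (1 * |ω - P.ω₀|) :=
    abs_score_le hP hv hρ hsig hs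
  have hSm : Measurable fun ω => P.score v ρ s ω := (P.measurable_score v ρ).of_uncurry_left
  have haff : ∀ ω, |ω - a| ≤ (1 + |P.ω₀ - a|) * Real.exp (1 * |ω - P.ω₀|) := fun ω => by
    simpa [sub_eq_add_neg] using abs_affine_le_exp 1 (-a) P.ω₀ ω
  have hexp : ∀ ω, Real.exp (2 * |ω - P.ω₀|) =
      Real.exp (1 * |ω - P.ω₀|) * Real.exp (1 * |ω - P.ω₀|) := fun ω => by
    rw [← Real.exp_add]; ring_nf
  have i0 := hP.integrable_joint hs
  have i1 : Integrable fun ω => (ω - a) * P.joint r s ω :=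
    hP.integrable_mul_joint hs (φ := fun ω => ω - a) (by fun_prop) haff
  have i2 : Integrable fun ω => ((ω - a) * P.score v ρ s ω) * P.joint r s ω :=
    hP.integrable_mul_joint hs (φ := fun ω => (ω - a) * P.score v ρ s ω) (by fun_prop)
      (C := (1 + |P.ω₀ - a|) * B) (c := 2) fun ω => by
      rw [abs_mul, hexp]
      refine (mul_le_mul (haff ω) (hB ω) (abs_nonneg _) (by positivity)).trans_eq ?_
      ring
  have i3 : Integrable fun ω => P.score v ρ s ω ^ 2 * P.joint r s ω :=
    hP.integrable_mul_joint hs (φ := fun ω => P.score v ρ s ω ^ 2) (by fun_prop)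
      (C := B ^ 2) (c := 2) fun ω => by
      rw [abs_pow, hexp]
      refine (pow_le_pow_left₀ (abs_nonneg _) (hB ω) 2).trans_eq ?_
      ring
  have i4 := hP.integrable_sub_sq_mul_joint hs a
  -- The total derivative of `(ω - a)` times the joint density integrates to `0`; this evaluates the
  -- cross moment of error and score.
  have hparts : ∫ ω, (P.joint r s ω + ((ω - a) * P.score v ρ s ω) * P.joint r s ω) = 0 := by
    refine integral_eq_zero_of_hasDerivAt_of_integrable (f := fun ω => (ω - a) * P.joint r s ω)
      (fun ω => ?_) (i0.add i2) i1
    refine (((hasDerivAt_id ω).sub_const a).mul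
      (hasDerivAt_joint hP hv hρ hsig hs ω)).congr_deriv ?_
    simp only [id]
    ring
  rw [integral_add i0 i2] at hparts
  -- From `(ω - a + k * score)² ≥ 0`. Keeping a free multiplier `k` makes the bound linear in the
  -- moments, so that it can be integrated over `s`.
  have hle : ∫ ω, (-(2 * k) * (((ω - a) * P.score v ρ s ω) * P.joint r s ω)
      - k ^ 2 * (P.score v ρ s ω ^ 2 * P.joint r s ω)) ≤ ∫ ω, (ω - a) ^ 2 * P.joint r s ω := by
    refine integral_mono ((i2.const_mul _).sub (i3.const_mul _)) i4 fun ω => ?_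
    have := mul_nonneg (sq_nonneg (ω - a + k * P.score v ρ s ω)) (hP.joint_nonneg r s ω)
    simp only
    nlinarith
  rw [integral_sub (i2.const_mul _) (i3.const_mul _), integral_const_mul,
    integral_const_mul] at hle
  have : ∫ ω, ((ω - a) * P.score v ρ s ω) * P.joint r s ω = -∫ ω, P.joint r s ω := by linarith
  rw [this] at hle
  linarith

/-- With a single signal quality, censoring at a finite radius is worse than not censoring. -/
lemma lt_loss_of_single_quality (hP : P.Admissible) (hv : v ≠ 0) (hρ : 0 < ρ)
    (hsig : ∀ s ω, P.signal s ω = gaussianPDFReal ω v s) :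
    ENNReal.ofReal (P.v₀ * v / (P.v₀ + v)) < P.loss (ENNReal.ofReal ρ) := by
  have hv' : (0 : ℝ) < v := by exact_mod_cast pos_iff_ne_zero.2 hv
  have hv₀ : (0 : ℝ) < P.v₀ := hP.v₀_pos
  have hρ0 : ENNReal.ofReal ρ ≠ 0 := by simpa using hρ
  -- Here `1 / k = 1 / v₀ + 1 / v` is the information without censoring. With information `J < 1 /
  -- k`, the bound `2 * k - k ^ 2 * J` exceeds `k`.
  set k : ℝ := P.v₀ * v / (P.v₀ + v) with hk
  have hkpos : 0 < k := by positivity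
  set r := ENNReal.ofReal ρ with hr
  set A := signalRange P.ω₀ r with hA
  set B : ℝ := 1 / P.v₀ + 2 * ρ / v
  have hAfin : IsFiniteMeasure (volume.restrict A) := ⟨by
    rw [Measure.restrict_apply_univ, hA, hr, signalRange_ofReal]; simp⟩
  have hu : 0 < min P.vH P.vL := lt_min hP.vH_pos hP.vL_pos
  set u := min P.vH P.vL
  set M := Real.exp (2 * ρ * ρ / u) / (2 * ρ)
  have hjle : ∀ s ∈ A, ∀ ω, P.joint r s ω
      ≤ M * (Real.exp (2 * ρ / u * |ω - P.ω₀|) * P.prior ω) := fun s hs ω =>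
    hP.joint_le hu (min_le_left _ _) (min_le_right _ _) hρ le_rfl
      ((ENNReal.ofReal_lt_ofReal_iff hρ).1 hs).le ω
  have hprod : ∀ᵐ x ∂((volume.restrict A).prod (volume : Measure ℝ)), x.1 ∈ A :=
    Measure.quasiMeasurePreserving_fst.ae (ae_restrict_mem (measurableSet_signalRange _ _))
  have hjm := hP.measurable_joint r
  have hSm := P.measurable_score v ρ
  have I0 : Integrable (fun x : ℝ × ℝ => P.joint r x.1 x.2)
      ((volume.restrict A).prod volume) := by
    refine (((hP.integrable_exp_mul_prior (2 * ρ / u)).const_mul M).comp_snd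
      (volume.restrict A)).mono' hjm.aestronglyMeasurable ?_
    filter_upwards [hprod] with x hx
    rw [Real.norm_of_nonneg (hP.joint_nonneg _ _ _)]
    exact hjle _ hx _
  have I2 : Integrable (fun x : ℝ × ℝ => P.score v ρ x.1 x.2 ^ 2 * P.joint r x.1 x.2)
      ((volume.restrict A).prod volume) := by
    refine (((hP.integrable_exp_mul_prior (2 + 2 * ρ / u)).const_mul (B ^ 2 * M)).comp_snd
      (volume.restrict A)).mono' ((hSm.pow_const 2).mul hjm).aestronglyMeasurable ?_
    filter_upwards [hprod] with x hx
    rw [Real.norm_of_nonneg (mul_nonneg (sq_nonneg _) (hP.joint_nonneg _ _ _)), ← sq_abs]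
    refine (mul_le_mul (pow_le_pow_left₀ (abs_nonneg _)
      (abs_score_le hP hv hρ hsig hx x.2) 2) (hjle _ hx _) (hP.joint_nonneg _ _ _)
      (by positivity)).trans_eq ?_
    have e : Real.exp ((2 + 2 * ρ / u) * |x.2 - P.ω₀|) = Real.exp (1 * |x.2 - P.ω₀|) ^ 2 *
        Real.exp (2 * ρ / u * |x.2 - P.ω₀|) := by
      rw [← Real.exp_nat_mul, ← Real.exp_add]
      push_cast
      ring_nf
    rw [e]
    ring
  have E0 : ∫ s in A, ∫ ω, P.joint r s ω = 1 := by
    rw [integral_integral_swap (f := fun s ω => P.joint r s ω) I0]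
    simp only [joint, integral_mul_const]
    simp only [hA, hP.setIntegral_trunc hρ0, one_mul, hP.integral_prior]
  have j1 : Integrable P.prior := integrable_gaussianPDFReal _ _
  have j2 := hP.integrable_sub_sq_mul_prior
  have E2 : ∫ s in A, ∫ ω, P.score v ρ s ω ^ 2 * P.joint r s ω < 1 / k := by
    rw [integral_integral_swap (f := fun s ω => P.score v ρ s ω ^ 2 * P.joint r s ω) I2]
    have eH : ∫ ω, (((P.v₀ : ℝ) ^ 2)⁻¹ * ((ω - P.ω₀) ^ 2 * P.prior ω) + (v : ℝ)⁻¹ * P.prior ω)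
        = 1 / k := by
      rw [integral_add (j2.const_mul _) (j1.const_mul _), integral_const_mul,
        integral_const_mul, hP.integral_prior]
      unfold prior
      rw [integral_sub_sq_mul_gaussianPDFReal _ hP.v₀_pos.ne', hk]
      field_simp
      ring
    have jH : Integrable fun ω => ((P.v₀ : ℝ) ^ 2)⁻¹ * ((ω - P.ω₀) ^ 2 * P.prior ω)
        + (v : ℝ)⁻¹ * P.prior ω := (j2.const_mul _).add (j1.const_mul _)
    have jS : Integrable fun ω => ∫ s in A, P.score v ρ s ω ^ 2 * P.joint r s ω :=
      I2.integral_prod_right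
    rw [← eH, ← sub_pos, ← integral_sub jH jS]
    -- The information is strictly smaller at every state, so the strict inequality survives
    -- integration.
    have hpos : ∀ ω, 0 < (((P.v₀ : ℝ) ^ 2)⁻¹ * ((ω - P.ω₀) ^ 2 * P.prior ω)
        + (v : ℝ)⁻¹ * P.prior ω) - ∫ s in A, P.score v ρ s ω ^ 2 * P.joint r s ω := by
      intro ω
      have h1 := mul_lt_mul_of_pos_right
        (setIntegral_score_sq_mul_trunc_lt hP hv hρ hsig ω) (hP.prior_pos ω)
      rw [← integral_mul_const] at h1
      simp only [joint, ← mul_assoc] at h1 ⊢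
      have e : ((ω - P.ω₀) ^ 2 / (P.v₀ : ℝ) ^ 2 + 1 / v) * P.prior ω =
        ((P.v₀ : ℝ) ^ 2)⁻¹ * (ω - P.ω₀) ^ 2 * P.prior ω + (v : ℝ)⁻¹ * P.prior ω := by ring
      rw [e] at h1
      linarith
    rw [integral_pos_iff_support_of_nonneg (fun ω => (hpos ω).le)
      (jH.sub jS)]
    have : Function.support (fun ω => (((P.v₀ : ℝ) ^ 2)⁻¹ * ((ω - P.ω₀) ^ 2 * P.prior ω)
        + (v : ℝ)⁻¹ * P.prior ω) - ∫ s in A, P.score v ρ s ω ^ 2 * P.joint r s ω) = Set.univ :=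
      Set.eq_univ_of_forall fun ω => (hpos ω).ne'
    rw [this]
    simp
  have hψ : Integrable (fun s => 2 * k * (∫ ω, P.joint r s ω)
      - k ^ 2 * ∫ ω, P.score v ρ s ω ^ 2 * P.joint r s ω) (volume.restrict A) :=
    (I0.integral_prod_left.const_mul _).sub (I2.integral_prod_left.const_mul _)
  have hlow : k < ∫ s in A, (2 * k * (∫ ω, P.joint r s ω)
      - k ^ 2 * ∫ ω, P.score v ρ s ω ^ 2 * P.joint r s ω) := by
    rw [integral_sub (I0.integral_prod_left.const_mul _) (I2.integral_prod_left.const_mul _),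
      integral_const_mul, integral_const_mul, E0]
    have h1 := mul_lt_mul_of_pos_left E2 (pow_pos hkpos 2)
    have h2 : k ^ 2 * (1 / k) = k := by field_simp
    linarith
  refine ((ENNReal.ofReal_lt_ofReal_iff (hkpos.trans hlow)).2 hlow).trans_le ?_
  refine (ofReal_integral_le_lintegral_ofReal hψ).trans ?_
  rw [hP.loss_eq hρ0]
  refine le_trans ?_ (setLIntegral_le_lintegral A _)
  refine setLIntegral_mono' (measurableSet_signalRange _ _) fun s hs => ?_
  rw [← ofReal_integral_eq_lintegral_ofReal (hP.integrable_sub_sq_mul_joint hs _)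
    (ae_of_all _ fun ω => mul_nonneg (sq_nonneg _) (hP.joint_nonneg _ _ _))]
  exact ENNReal.ofReal_le_ofReal (le_integral_sub_sq_mul_joint hP hv hρ hsig hs _ k)

end NormalParams


namespace NormalParams

variable {P : NormalParams} {v : ℝ≥0}

/-! ### A single signal quality -/

/-- The normal prior is conjugate to a normal signal. -/
lemma gaussianPDFReal_mul_gaussianPDFReal {v w : ℝ≥0} (hv : 0 < v) (hw : 0 < w) (c s : ℝ) :
    ∃ K : ℝ, 0 < K ∧ ∀ ω, gaussianPDFReal ω v s * gaussianPDFReal c w ω =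
      K * gaussianPDFReal ((v * c + w * s) / (w + v)) (w * v / (w + v)) ω := by
  have hv' : (0 : ℝ) < v := hv
  have hw' : (0 : ℝ) < w := hw
  -- The constant is the marginal density of the signal, normal with mean `c` and variance `w + v`,
  -- in unsimplified form.
  refine ⟨(√(2 * Real.pi * v))⁻¹ * (√(2 * Real.pi * w))⁻¹ *
    √(2 * Real.pi * (w * v / (w + v))) * Real.exp (-(s - c) ^ 2 / (2 * (w + v))),
    by positivity, fun ω => ?_⟩
  have h1 : √(2 * Real.pi * (w * v / (w + v) : ℝ)) ≠ 0 := (Real.sqrt_pos.2 (by positivity)).ne'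
  simp only [gaussianPDFReal]
  push_cast
  have e : Real.exp (-(s - ω) ^ 2 / (2 * v)) * Real.exp (-(ω - c) ^ 2 / (2 * w)) =
      Real.exp (-(s - c) ^ 2 / (2 * (w + v))) *
        Real.exp (-(ω - (v * c + w * s) / (w + v)) ^ 2 / (2 * (w * v / (w + v)))) := by
    rw [← Real.exp_add, ← Real.exp_add]
    congr 1
    field_simp
    ring
  calc _ = (√(2 * Real.pi * v))⁻¹ * (√(2 * Real.pi * w))⁻¹ *
        (Real.exp (-(s - ω) ^ 2 / (2 * v)) * Real.exp (-(ω - c) ^ 2 / (2 * w))) := by ring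
    _ = _ := by rw [e]; field_simp

lemma Admissible.optAction_top (hP : P.Admissible) (hv : 0 < v)
    (hsig : ∀ s ω, P.signal s ω = gaussianPDFReal ω v s) (s : ℝ) :
    P.optAction s ⊤ = v * P.ω₀ / (P.v₀ + v) + P.v₀ / (P.v₀ + v) * s := by
  obtain ⟨K, hK, h⟩ := gaussianPDFReal_mul_gaussianPDFReal hv hP.v₀_pos P.ω₀ s
  have hτ : P.v₀ * v / (P.v₀ + v) ≠ 0 :=
    (div_pos (mul_pos hP.v₀_pos hv) (add_pos hP.v₀_pos hv)).ne'
  have hj : ∀ ω, P.joint ⊤ s ω =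
      K * gaussianPDFReal ((v * P.ω₀ + P.v₀ * s) / (P.v₀ + v)) (P.v₀ * v / (P.v₀ + v)) ω := by
    intro ω
    rw [joint, hP.trunc_eq (by simp), hP.mass_top, div_one, hsig, prior, h]
  rw [optAction_eq ENNReal.top_ne_zero]
  simp only [hj, mul_left_comm _ K]
  rw [integral_const_mul, integral_const_mul, integral_mul_gaussianPDFReal _ hτ,
    integral_gaussianPDFReal_eq_one _ hτ]
  field_simp

/-- With a single signal quality, every finite radius has a loss above the uncensored one. -/
lemma Admissible.lt_loss (hP : P.Admissible) (hv : 0 < v)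
    (hsig : ∀ s ω, P.signal s ω = gaussianPDFReal ω v s) {r : ℝ≥0∞} (hr : r ≠ ⊤) :
    ENNReal.ofReal (P.v₀ * v / (P.v₀ + v)) < P.loss r := by
  have hv' : (0 : ℝ) < v := hv
  have hv₀ : (0 : ℝ) < P.v₀ := hP.v₀_pos
  rcases eq_or_ne r 0 with rfl | hr0
  · rw [hP.loss_zero, ← ENNReal.ofReal_coe_nnreal, ENNReal.ofReal_lt_ofReal_iff hv₀,
      div_lt_iff₀ (by positivity)]
    nlinarith
  · rw [← ENNReal.ofReal_toReal hr]
    exact lt_loss_of_single_quality hP hv.ne' (ENNReal.toReal_pos hr0 hr) hsig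

/-- The slope `v₀ / (v₀ + v)` minimizes `(1 - c)² v₀ + c² v`. -/
lemma Admissible.loss_top_le_of_single_quality (hP : P.Admissible) (hv : 0 < v)
    (hvar : P.h * P.vH + (1 - P.h) * P.vL = v) :
    P.loss ⊤ ≤ ENNReal.ofReal (P.v₀ * v / (P.v₀ + v)) := by
  have hv' : (0 : ℝ) < v := hv
  have hv₀ : (0 : ℝ) < P.v₀ := hP.v₀_pos
  refine (hP.loss_top_le (P.v₀ / (P.v₀ + v))).trans_eq ?_
  rw [hvar]
  congr 1
  field_simp
  ring

/-- Without quality uncertainty, the signal is normal. -/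
lemma exists_single_quality (hP : P.Admissible) (h : P.vH = P.vL ∨ P.h = 0 ∨ P.h = 1) :
    ∃ v : ℝ≥0, 0 < v ∧ (∀ s ω, P.signal s ω = gaussianPDFReal ω v s) ∧
      P.h * P.vH + (1 - P.h) * P.vL = v := by
  rcases h with h | h | h
  · refine ⟨P.vL, hP.vL_pos, fun s ω => ?_, ?_⟩
    · rw [signal, h]; ring
    · rw [h]; ring
  · exact ⟨P.vL, hP.vL_pos, fun s ω => by simp [signal, h], by simp [h]⟩
  · exact ⟨P.vH, hP.vH_pos, fun s ω => by simp [signal, h], by simp [h]⟩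

lemma Admissible.isOptimalRadius_iff (hP : P.Admissible)
    (h : P.vH = P.vL ∨ P.h = 0 ∨ P.h = 1) (r : ℝ≥0∞) : P.IsOptimalRadius r ↔ r = ⊤ := by
  obtain ⟨v, hv, hsig, hvar⟩ := exists_single_quality hP h
  have htop := hP.loss_top_le_of_single_quality hv hvar
  constructor
  · intro hr
    by_contra hne
    exact absurd ((hP.lt_loss hv hsig hne).trans_le (hr ⊤)) (not_lt.2 htop)
  · rintro rfl r'
    rcases eq_or_ne r' ⊤ with rfl | hne
    · exact le_rfl
    · exact htop.trans (hP.lt_loss hv hsig hne).le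

/-! ### Existence of an optimal radius -/

lemma Admissible.exists_isOptimalRadius (hP : P.Admissible) : ∃ r, P.IsOptimalRadius r := by
  have hlsc : LowerSemicontinuous P.loss := by
    rw [lowerSemicontinuous_iff_le_liminf]
    intro r
    -- The parameters are held constant, and only the radius moves in the compact space `[0, ∞]`.
    refine Converges.loss_le_liminf (P := fun _ : ℝ≥0∞ => P) (r := fun r => r) ?_
      (fun _ => hP) hP tendsto_id
    exact ⟨fun _ => rfl, fun _ => rfl, tendsto_const_nhds, tendsto_const_nhds,
      tendsto_const_nhds⟩
  obtain ⟨r, -, hr⟩ := (hlsc.lowerSemicontinuousOn Set.univ).exists_isMinOn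
    Set.univ_nonempty isCompact_univ
  exact ⟨r, fun R => hr (Set.mem_univ R)⟩

/-! ### Limits along arbitrary filters -/

/-- Variances and share of an admissible model, and a radius. -/
abbrev ParamSpace : Type :=
  {x : ℝ≥0 × ℝ≥0 × ℝ × ℝ≥0∞ // 0 < x.1 ∧ 0 < x.2.1 ∧ x.2.2.1 ∈ Set.Icc (0 : ℝ) 1}

/-- Makes neighbourhood filters countably generated, as Fatou and dominated convergence require.
Limits at a point of the parameter space can then be pulled back along an arbitrary filter,
ultrafilters included. -/
instance : FirstCountableTopology ParamSpace :=
  TopologicalSpace.Subtype.firstCountableTopology _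

/-- The model with given prior and a given point of the parameter space. -/
def ofParam (ω₀ : ℝ) (v₀ : ℝ≥0) (x : ParamSpace) : NormalParams :=
  ⟨ω₀, v₀, x.1.1, x.1.2.1, x.1.2.2.1⟩

lemma admissible_ofParam (ω₀ : ℝ) {v₀ : ℝ≥0} (hv₀ : 0 < v₀) (x : ParamSpace) :
    (ofParam ω₀ v₀ x).Admissible := ⟨hv₀, x.2.1, x.2.2.1, x.2.2.2⟩

lemma converges_ofParam (ω₀ : ℝ) (v₀ : ℝ≥0) (x : ParamSpace) :
    Converges (ofParam ω₀ v₀) (𝓝 x) (ofParam ω₀ v₀ x) where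
  ω₀_eq _ := rfl
  v₀_eq _ := rfl
  vH := (Continuous.tendsto (by fun_prop) x : Tendsto (fun y : ParamSpace => y.1.1) _ _)
  vL := (Continuous.tendsto (by fun_prop) x : Tendsto (fun y : ParamSpace => y.1.2.1) _ _)
  h := (Continuous.tendsto (by fun_prop) x : Tendsto (fun y : ParamSpace => y.1.2.2.1) _ _)

lemma tendsto_radius (x : ParamSpace) :
    Tendsto (fun y : ParamSpace => y.1.2.2.2) (𝓝 x) (𝓝 x.1.2.2.2) :=
  Continuous.tendsto (by fun_prop) x

section Filters

variable {ι : Type*} {l : Filter ι} {ω₀ : ℝ} {v₀ vH' vL' : ℝ≥0} {vH vL : ι → ℝ≥0}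
  {h : ι → ℝ} {h' : ℝ} {r : ι → ℝ≥0∞} {r' : ℝ≥0∞}

/-- Points of the parameter space converge when their coordinates do. -/
lemma tendsto_paramSpace
    (hvH : ∀ i, 0 < vH i) (hvL : ∀ i, 0 < vL i) (hh : ∀ i, h i ∈ Set.Icc (0 : ℝ) 1)
    (hvH' : 0 < vH') (hvL' : 0 < vL') (hh' : h' ∈ Set.Icc (0 : ℝ) 1)
    (limH : Tendsto vH l (𝓝 vH')) (limL : Tendsto vL l (𝓝 vL')) (limh : Tendsto h l (𝓝 h'))
    (limr : Tendsto r l (𝓝 r')) :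
    Tendsto (fun i => (⟨(vH i, vL i, h i, r i), hvH i, hvL i, hh i⟩ : ParamSpace)) l
      (𝓝 ⟨(vH', vL', h', r'), hvH', hvL', hh'⟩) :=
  tendsto_subtype_rng.2 (limH.prodMk_nhds (limL.prodMk_nhds (limh.prodMk_nhds limr)))

/-- Lower semicontinuity as an open condition on the parameter space, hence usable along any filter.
-/
lemma eventually_lt_loss (hv₀ : 0 < v₀)
    (hvH : ∀ i, 0 < vH i) (hvL : ∀ i, 0 < vL i) (hh : ∀ i, h i ∈ Set.Icc (0 : ℝ) 1)
    (hvH' : 0 < vH') (hvL' : 0 < vL') (hh' : h' ∈ Set.Icc (0 : ℝ) 1)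
    (limH : Tendsto vH l (𝓝 vH')) (limL : Tendsto vL l (𝓝 vL')) (limh : Tendsto h l (𝓝 h'))
    (limr : Tendsto r l (𝓝 r')) {y : ℝ≥0∞} (hy : y < (mk ω₀ v₀ vH' vL' h').loss r') :
    ∀ᶠ i in l, y < (mk ω₀ v₀ (vH i) (vL i) (h i)).loss (r i) := by
  have hlsc : LowerSemicontinuous fun x : ParamSpace => (ofParam ω₀ v₀ x).loss x.1.2.2.2 := by
    rw [lowerSemicontinuous_iff_le_liminf]
    intro x
    exact (converges_ofParam ω₀ v₀ x).loss_le_liminf (admissible_ofParam ω₀ hv₀)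
      (admissible_ofParam ω₀ hv₀ x) (tendsto_radius x)
  exact (tendsto_paramSpace hvH hvL hh hvH' hvL' hh' limH limL limh limr).eventually
    (hlsc _ y hy)

lemma tendsto_optAction_top (hv₀ : 0 < v₀)
    (hvH : ∀ i, 0 < vH i) (hvL : ∀ i, 0 < vL i) (hh : ∀ i, h i ∈ Set.Icc (0 : ℝ) 1)
    (hvH' : 0 < vH') (hvL' : 0 < vL') (hh' : h' ∈ Set.Icc (0 : ℝ) 1)
    (limH : Tendsto vH l (𝓝 vH')) (limL : Tendsto vL l (𝓝 vL')) (limh : Tendsto h l (𝓝 h'))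
    (limr : Tendsto r l (𝓝 ⊤)) (s : ℝ) :
    Tendsto (fun i => (mk ω₀ v₀ (vH i) (vL i) (h i)).optAction s (r i)) l
      (𝓝 ((mk ω₀ v₀ vH' vL' h').optAction s ⊤)) := by
  have hlim := tendsto_paramSpace hvH hvL hh hvH' hvL' hh' limH limL limh limr
  set x : ParamSpace := ⟨(vH', vL', h', ⊤), hvH', hvL', hh'⟩
  have hs : s ∈ signalRange (ofParam ω₀ v₀ x).ω₀ x.1.2.2.2 := by simp [x]
  exact ((converges_ofParam ω₀ v₀ x).tendsto_optAction (admissible_ofParam ω₀ hv₀)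
    (admissible_ofParam ω₀ hv₀ x) (tendsto_radius x) hs).comp hlim

/-- In the limit without quality uncertainty, optimal radii tend to infinity. -/
lemma eq_top_of_tendsto_isOptimalRadius [l.NeBot] (hv₀ : 0 < v₀)
    (hvH : ∀ i, 0 < vH i) (hvL : ∀ i, 0 < vL i) (hh : ∀ i, h i ∈ Set.Icc (0 : ℝ) 1)
    (hvH' : 0 < vH') (hvL' : 0 < vL') (hh' : h' ∈ Set.Icc (0 : ℝ) 1)
    (limH : Tendsto vH l (𝓝 vH')) (limL : Tendsto vL l (𝓝 vL')) (limh : Tendsto h l (𝓝 h'))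
    (limr : Tendsto r l (𝓝 r')) {v : ℝ≥0} (hv : 0 < v)
    (hsig : ∀ s ω, (mk ω₀ v₀ vH' vL' h').signal s ω = gaussianPDFReal ω v s)
    (hvar : h' * vH' + (1 - h') * vL' = v)
    (hopt : ∀ i, (mk ω₀ v₀ (vH i) (vL i) (h i)).IsOptimalRadius (r i)) : r' = ⊤ := by
  by_contra hr'
  have hP' : (mk ω₀ v₀ vH' vL' h').Admissible := ⟨hv₀, hvH', hvL', hh'⟩
  obtain ⟨y, hy1, hy2⟩ := exists_between (hP'.lt_loss hv hsig hr')
  have h1 := eventually_lt_loss hv₀ hvH hvL hh hvH' hvL' hh' limH limL limh limr hy2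
  have hv' : (0 : ℝ) < v := hv
  have hv₀' : (0 : ℝ) < v₀ := hv₀
  -- The slope is frozen at the best one for the limiting model, so the uncensored loss bound
  -- depends continuously on the parameters.
  set c : ℝ := v₀ / (v₀ + v) with hc
  have h2 : Tendsto (fun i => ENNReal.ofReal
      ((1 - c) ^ 2 * v₀ + c ^ 2 * (h i * vH i + (1 - h i) * vL i))) l
      (𝓝 (ENNReal.ofReal (v₀ * v / (v₀ + v)))) := by
    have e : (v₀ * v / (v₀ + v) : ℝ)
        = (1 - c) ^ 2 * v₀ + c ^ 2 * (h' * vH' + (1 - h') * vL') := by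
      rw [hvar, hc]; field_simp; ring
    rw [e]
    exact ENNReal.tendsto_ofReal ((((limh.mul (NNReal.tendsto_coe.2 limH)).add
      ((limh.const_sub 1).mul (NNReal.tendsto_coe.2 limL))).const_mul _).const_add _)
  obtain ⟨i, hi1, hi2⟩ := (h1.and (h2.eventually (gt_mem_nhds hy1))).exists
  have hPi : (mk ω₀ v₀ (vH i) (vL i) (h i)).Admissible := ⟨hv₀, hvH i, hvL i, hh i⟩
  exact lt_irrefl _ (((hi1.trans_le (hopt i ⊤)).trans_le (hPi.loss_top_le c)).trans hi2)

/-- The limit of the signal variance, and the limits of the share along ultrafilters. -/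
lemma exists_limit_quality (hh : ∀ i, h i ∈ Set.Icc (0 : ℝ) 1)
    (hvH' : 0 < vH') (hvL' : 0 < vL')
    (limH : Tendsto vH l (𝓝 vH')) (limL : Tendsto vL l (𝓝 vL'))
    (hlim : Tendsto (fun i => |(vH i : ℝ) - (vL i : ℝ)|) l (𝓝 0) ∨
      Tendsto h l (𝓝 0) ∨ Tendsto h l (𝓝 1)) :
    ∃ v : ℝ≥0, 0 < v ∧ ∀ U : Ultrafilter ι, ↑U ≤ l → ∃ h' ∈ Set.Icc (0 : ℝ) 1,
      Tendsto h U (𝓝 h') ∧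
      (∀ s ω, (mk ω₀ v₀ vH' vL' h').signal s ω = gaussianPDFReal ω v s) ∧
      h' * vH' + (1 - h') * vL' = v := by
  rcases hlim with hlim | hlim | hlim
  · refine ⟨vL', hvL', fun U hU => ?_⟩
    have h1 : Tendsto (fun i => |(vH i : ℝ) - (vL i : ℝ)|) U (𝓝 |(vH' : ℝ) - vL'|) :=
      ((NNReal.tendsto_coe.2 (limH.mono_left hU)).sub
        (NNReal.tendsto_coe.2 (limL.mono_left hU))).abs
    have h2 : (vH' : ℝ) = vL' := by
      have := tendsto_nhds_unique h1 (hlim.mono_left hU)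
      rwa [abs_eq_zero, sub_eq_zero] at this
    have h3 : vH' = vL' := by exact_mod_cast h2
    -- The share itself need not converge here. Its limit may depend on the ultrafilter, but not the
    -- limiting signal, since both variances agree.
    obtain ⟨h', hh', hle⟩ := isCompact_Icc.ultrafilter_le_nhds' (U.map h)
      (Eventually.of_forall hh : ∀ᶠ i in (U : Filter ι), h i ∈ Set.Icc (0 : ℝ) 1)
    refine ⟨h', hh', hle, fun s ω => ?_, ?_⟩
    · simp only [signal, h3]; ring
    · rw [h2]; ring
  · exact ⟨vL', hvL', fun U hU => ⟨0, by simp, hlim.mono_left hU, by simp [signal], by simp⟩⟩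
  · exact ⟨vH', hvH', fun U hU => ⟨1, by simp, hlim.mono_left hU, by simp [signal], by simp⟩⟩

end Filters

end NormalParams

end EchoChamber

end

/-! ### The proposition -/

theorem mainTheorem5 {ι : Type*} {l : Filter ι}
    (ω₀ : ℝ) (v₀ : ℝ≥0) (hv₀ : 0 < v₀)
    (vH vL : ι → ℝ≥0) (h : ι → ℝ)
    (hvH : ∀ i, 0 < vH i) (hvL : ∀ i, 0 < vL i) (hh : ∀ i, h i ∈ Set.Icc (0 : ℝ) 1)
    (vH' vL' : ℝ≥0) (hvH' : 0 < vH') (hvL' : 0 < vL')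
    (limH : Tendsto vH l (𝓝 vH')) (limL : Tendsto vL l (𝓝 vL'))
    (hlim : Tendsto (fun i => |(vH i : ℝ) - (vL i : ℝ)|) l (𝓝 0) ∨
      Tendsto h l (𝓝 0) ∨ Tendsto h l (𝓝 1)) :
    -- an optimal radius exists
    (∀ i, ∃ r : ℝ≥0∞, (EchoChamber.NormalParams.mk ω₀ v₀ (vH i) (vL i) (h i)).IsOptimalRadius r) ∧
    -- optimal radii tend to infinity, and the action tends to an increasing linear function of `s`
    (∃ b c : ℝ, 0 < c ∧
      (∀ rstar : ι → ℝ≥0∞,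
        (∀ i, (EchoChamber.NormalParams.mk ω₀ v₀ (vH i) (vL i) (h i)).IsOptimalRadius (rstar i)) →
        Tendsto rstar l (𝓝 ⊤) ∧
        ∀ s : ℝ, Tendsto
          (fun i => (EchoChamber.NormalParams.mk ω₀ v₀ (vH i) (vL i) (h i)).optAction s (rstar i))
          l (𝓝 (b + c * s))) ∧
      ∀ s : ℝ, Tendsto
        (fun i => (EchoChamber.NormalParams.mk ω₀ v₀ (vH i) (vL i) (h i)).optAction s ⊤)
        l (𝓝 (b + c * s))) ∧
    -- without quality uncertainty, not censoring is the only optimum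
    (∀ i, (vH i = vL i ∨ h i = 0 ∨ h i = 1) → ∀ r : ℝ≥0∞,
      (EchoChamber.NormalParams.mk ω₀ v₀ (vH i) (vL i) (h i)).IsOptimalRadius r ↔ r = ⊤) := by
  have hP : ∀ i, (EchoChamber.NormalParams.mk ω₀ v₀ (vH i) (vL i) (h i)).Admissible :=
    fun i => ⟨hv₀, hvH i, hvL i, hh i⟩
  refine ⟨fun i => (hP i).exists_isOptimalRadius, ?_,
    fun i hi r => (hP i).isOptimalRadius_iff hi r⟩
  obtain ⟨v, hv, hU⟩ := EchoChamber.NormalParams.exists_limit_quality (ω₀ := ω₀) (v₀ := v₀)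
    hh hvH' hvL' limH limL hlim
  have hv₀' : (0 : ℝ) < v₀ := hv₀
  have hv' : (0 : ℝ) < v := hv
  have hact : ∀ r : ι → ℝ≥0∞, Tendsto r l (𝓝 ⊤) → ∀ s : ℝ, Tendsto
      (fun i => (EchoChamber.NormalParams.mk ω₀ v₀ (vH i) (vL i) (h i)).optAction s (r i)) l
      (𝓝 (v * ω₀ / (v₀ + v) + v₀ / (v₀ + v) * s)) := by
    intro r hr s
    rw [tendsto_iff_ultrafilter]
    intro U hUl
    obtain ⟨h', hh', limh, hsig, -⟩ := hU U hUl
    have hP' : (EchoChamber.NormalParams.mk ω₀ v₀ vH' vL' h').Admissible :=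
      ⟨hv₀, hvH', hvL', hh'⟩
    have := EchoChamber.NormalParams.tendsto_optAction_top (ω₀ := ω₀) hv₀ hvH hvL hh hvH' hvL' hh'
      (limH.mono_left hUl) (limL.mono_left hUl) limh (hr.mono_left hUl) s
    rwa [hP'.optAction_top hv hsig] at this
  refine ⟨v * ω₀ / (v₀ + v), v₀ / (v₀ + v), by positivity, fun rstar hopt => ?_,
    hact _ tendsto_const_nhds⟩
  have hr : Tendsto rstar l (𝓝 ⊤) := by
    rw [tendsto_iff_ultrafilter]
    intro U hUl
    obtain ⟨h', hh', limh, hsig, hvar⟩ := hU U hUl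
    -- By compactness of `[0, ∞]` the optimal radii converge along the ultrafilter; it remains to
    -- identify the limit.
    obtain ⟨r', -, hle⟩ := isCompact_univ.ultrafilter_le_nhds' (U.map rstar) univ_mem
    have limr : Tendsto rstar U (𝓝 r') := hle
    have := EchoChamber.NormalParams.eq_top_of_tendsto_isOptimalRadius hv₀ hvH hvL hh hvH' hvL' hh'
      (limH.mono_left hUl) (limL.mono_left hUl) limh limr hv hsig hvar hopt
    rwa [this] at limr
  exact ⟨hr, hact rstar hr⟩
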